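/- Let $n\ge 1$ and $X=\mathbb P^n_{\mathbb C}$, so that $-K_X=\mathcal O(n+1)$; take the minimal level $k=1/(n+1)$, for which $-kK_X=\mathcal O(1)$ and $N=\dim H^0(X,-kK_X)=n+1$. Let $dV$ be the Fubini–Study volume form, given in the affine chart $z\mapsto[1:z_1:\dots:z_n]$ by $(1+|z|^2)^{-(n+1)}\,d\lambda(z)$, with $d\lambda$ Lebesgue measure, and let $$\|\det S\|(x_1,\dots,x_{n+1})=\frac{|\det(\mathbf Z_1,\dots,\mathbf Z_{n+1})|}{|\mathbf Z_1|\cdots|\mathbf Z_{n+1}|},\qquad x_j=[\mathbf Z_j],\ \mathbf Z_j\in\mathbb C^{n+1}\setminus\{0\},$$ be the Fubini–Study norm of the Slater determinant of the basis of $H^0(\mathbb P^n,\mathcal O(1))$ given by the homogeneous coordinates. Put $$\mathcal Z(\beta)=\int_{(\mathbb P^n)^{n+1}}\|\det S\|^{2\beta/k}\,dV^{\otimes(n+1)},\qquad \Omega=\{\beta\in\mathbb C:\operatorname{Re}\beta>-1/(n+1)\}.$$ Then: (1) The integral converges absolutely if and only if $\beta\in\Omega$. (2) There is a constant $c_n>0$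 depending only on $n$ such that for all $\beta\in\Omega$ $$\mathcal Z(\beta)=c_n\,\frac{\prod_{j=1}^n\Gamma(\beta(n+1)+j)}{\Gamma(\beta(n+1)+n+1)^n},$$ and $\mathcal Z$ extends to a meromorphic function on $\mathbb C$, given by the same formula at every $\beta$ with $\beta(n+1)\notin\{-1,-2,\dots\}$; this extension has no zeros in $\mathbb C$. (3) $\mathcal Z$ is holomorphic and zero-free on $\Omega$, and $\Omega$ is the maximal strip of holomorphicity: for no $a<-1/(n+1)$ does $\mathcal Z$ extend holomorphically to $\{\operatorname{Re}\beta>a\}$. (4) For $\beta\in\Omega$ and $s=\beta(n+1)$ the zeta integral of the trivial representation of $GL(n+1,\mathbb C)$, $$L(s)=\int_{\mathrm{Mat}(n+1,\mathbb C)}|\det A|^{2s}e^{-|A|^2}\,dA,\qquad |A|^2=\sum_{i,j}|A_{ij}|^2,$$ with $dA$ Lebesgue measure, converges absolutely, and $$\mathcal Z(\beta)=c_n'\,\Gamma(s+n+1)^{-(n+1)}L(s),\qquad L(s)=c_n''\,(2\pi)^{(n+1)s}\,L\!\left(s+\tfrac{n+2}2,\mathbf 1_{GL(n+1,\mathbb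 C)}\right),$$ with constants $c_n',c_n''>0$ depending only on $n$. Here $L(w,\mathbf 1_{GL(N,\mathbb C)})=\prod_{j=1}^{N}\Gamma_{\mathbb C}\!\left(w+\tfrac{N+1}2-j\right)$, with $\Gamma_{\mathbb C}(w)=2(2\pi)^{-w}\Gamma(w)$, is the standard local L-factor of the trivial representation. -/

import Mathlib

open MeasureTheory
open scoped LinearAlgebra.Projectivization

noncomputable section

/-- Complex projective space `ℙⁿ`: the lines through the origin of `ℂⁿ⁺¹`. -/
abbrev CPn (n : ℕ) : Type := ℙ ℂ (EuclideanSpace ℂ (Fin (n + 1)))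

/-- The quotient topology of `ℂⁿ⁺¹ ∖ {0} → ℙⁿ`. -/
instance CPn.instTopologicalSpace (n : ℕ) : TopologicalSpace (CPn n) :=
  TopologicalSpace.coinduced
    (fun v : {v : EuclideanSpace ℂ (Fin (n + 1)) // v ≠ 0} => Projectivization.mk ℂ v.1 v.2)
    inferInstance

/-- The Borel σ-algebra of `ℙⁿ`. -/
instance CPn.instMeasurableSpace (n : ℕ) : MeasurableSpace (CPn n) := borel (CPn n)

instance CPn.instBorelSpace (n : ℕ) : BorelSpace (CPn n) := ⟨rfl⟩

/-- The vector `(1, z₁, …, zₙ)` of `ℂⁿ⁺¹`. -/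
def affineVec (n : ℕ) (z : Fin n → ℂ) : EuclideanSpace ℂ (Fin (n + 1)) :=
  WithLp.toLp 2 (Fin.cons 1 z)

theorem affineVec_ne_zero (n : ℕ) (z : Fin n → ℂ) : affineVec n z ≠ 0 := by
  intro h
  have h0 := congrArg (fun v : EuclideanSpace ℂ (Fin (n + 1)) => v 0) h
  simp [affineVec] at h0

/-- The affine chart `z ↦ [1 : z₁ : ⋯ : zₙ]` of `ℙⁿ`. -/
def affineChart (n : ℕ) (z : Fin n → ℂ) : CPn n :=
  Projectivization.mk ℂ (affineVec n z) (affineVec_ne_zero n z)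

/-- The Fubini–Study volume form on `ℙⁿ`.  The Fubini–Study metric on `-K = 𝒪(n+1)` gives the
local frame `∂/∂z₁ ∧ ⋯ ∧ ∂/∂zₙ` (that is, `Z₀ⁿ⁺¹`) the squared length
`(|Z₀|² / |Z|²)ⁿ⁺¹ = (1 + |z|²)^{-(n+1)}`, so this is the density of the corresponding volume form
with respect to Lebesgue measure `dλ(z)` in the affine chart.  The hyperplane `Z₀ = 0` that the
chart misses is a null set of any volume form. -/
def fsVolume (n : ℕ) : Measure (CPn n) :=
  ((volume : Measure (Fin n → ℂ)).withDensity
    (fun z => ENNReal.ofReal (((1 + ∑ i, ‖z i‖ ^ 2) ^ (n + 1))⁻¹))).map (affineChart n)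

/-- Holomorphic sections of `𝒪(1) → ℙⁿ`, i.e. linear forms on `ℂⁿ⁺¹`. -/
abbrev SectionsO1 (n : ℕ) : Type := Module.Dual ℂ (EuclideanSpace ℂ (Fin (n + 1)))

/-- The `i`-th homogeneous coordinate `Zᵢ`, as a section of `𝒪(1)`. -/
def coordSection (n : ℕ) (i : Fin (n + 1)) : SectionsO1 n where
  toFun v := v i
  map_add' _ _ := rfl
  map_smul' _ _ := rfl

/-- The pointwise Fubini–Study norm `‖det S‖(x₁, …, x_N) = |det (sᵢ(Zⱼ))| / (|Z₁| ⋯ |Z_N|)` of the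
Slater determinant of sections `s₁, …, s_N` of `𝒪(1)`, where `Zⱼ` is any vector representing the
point `xⱼ` of `ℙⁿ`. -/
def slaterNorm {n N : ℕ} (s : Fin N → SectionsO1 n) (x : Fin N → CPn n) : ℝ :=
  ‖Matrix.det (Matrix.of fun i j => s i (x j).rep)‖ / ∏ j, ‖(x j).rep‖

/-- The norm does not depend on the representatives. -/
theorem slaterNorm_mk {n N : ℕ} (s : Fin N → SectionsO1 n)
    (Z : Fin N → EuclideanSpace ℂ (Fin (n + 1))) (hZ : ∀ j, Z j ≠ 0) :
    slaterNorm s (fun j => Projectivization.mk ℂ (Z j) (hZ j)) =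
      ‖Matrix.det (Matrix.of fun i j => s i (Z j))‖ / ∏ j, ‖Z j‖ := by
  choose a ha using fun j => Projectivization.exists_smul_eq_mk_rep ℂ (Z j) (hZ j)
  have key : (Matrix.of fun i j => s i (Projectivization.mk ℂ (Z j) (hZ j)).rep) =
      Matrix.of fun i j => (a j : ℂ) * (Matrix.of fun i j => s i (Z j)) i j := by
    ext i j
    simp [← ha j, Units.smul_def]
  have hn : ∀ j, ‖(Projectivization.mk ℂ (Z j) (hZ j)).rep‖ = ‖(a j : ℂ)‖ * ‖Z j‖ := by
    intro j
    rw [← ha j, Units.smul_def, norm_smul]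
  unfold slaterNorm
  rw [key, Matrix.det_mul_row, norm_mul, norm_prod]
  simp only [hn, Finset.prod_mul_distrib]
  rw [mul_div_mul_left]
  exact Finset.prod_ne_zero_iff.mpr fun j _ => norm_ne_zero_iff.mpr (a j).ne_zero

/-- The minimal level `k = 1/(n+1)` on `ℙⁿ`, for which `-kK = 𝒪(1)` and `N = dim H⁰(𝒪(1)) = n+1`. -/
def minLevel (n : ℕ) : ℂ := 1 / ((n : ℂ) + 1)

/-- The integrand `‖det S‖^{2β/k}` on `(ℙⁿ)ⁿ⁺¹` at the minimal level, for the basis of `H⁰(𝒪(1))`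
given by the homogeneous coordinates. -/
def partitionIntegrand (n : ℕ) (β : ℂ) (x : Fin (n + 1) → CPn n) : ℂ :=
  (slaterNorm (coordSection n) x : ℂ) ^ (2 * β / minLevel n)

/-- The partition function `𝒵(β) = ∫_{(ℙⁿ)ⁿ⁺¹} ‖det S‖^{2β/k} dV^{⊗(n+1)}`. -/
def partitionFunction (n : ℕ) (β : ℂ) : ℂ :=
  ∫ x, partitionIntegrand n β x ∂(Measure.pi fun _ : Fin (n + 1) => fsVolume n)

/-- The half-plane `Re β > -1/(n+1)`. -/
def strip (n : ℕ) : Set ℂ := {β | -(1 / ((n : ℝ) + 1)) < β.re}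

/-- `∏_{j=1}^n Γ(β(n+1)+j) / Γ(β(n+1)+n+1)^n`. -/
def gammaQuotient (n : ℕ) (β : ℂ) : ℂ :=
  (∏ j ∈ Finset.Icc 1 n, Complex.Gamma (β * (n + 1) + j)) /
    Complex.Gamma (β * (n + 1) + n + 1) ^ n

/-- The integrand `|det A|_ℂ^s e^{-|A|²}` on `Mat(N, ℂ)`; here `|z|_ℂ = |z|²` is the normalized
absolute value of `ℂ`. -/
def zetaIntegrand (N : ℕ) (s : ℂ) (A : Fin N → Fin N → ℂ) : ℂ :=
  ((‖Matrix.det (Matrix.of A)‖ ^ 2 : ℝ) : ℂ) ^ s * (Real.exp (-∑ i, ∑ j, ‖A i j‖ ^ 2) : ℂ)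

/-- The Archimedean zeta integral `∫_{Mat(N, ℂ)} |det A|_ℂ^s e^{-|A|²} dA` of the trivial
representation of `GL(N, ℂ)`, with `dA` Lebesgue measure. -/
def zetaIntegral (N : ℕ) (s : ℂ) : ℂ :=
  ∫ A : Fin N → Fin N → ℂ, zetaIntegrand N s A

/-- The standard local L-factor of the trivial representation of `GL(N, ℂ)`:
`L(s, 1) = ∏_{j=1}^N Γ_ℂ(s + (N+1)/2 - j)` with `Γ_ℂ(s) = 2 (2π)^{-s} Γ(s)`. -/
def standardLFactor (N : ℕ) (s : ℂ) : ℂ :=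
  ∏ j ∈ Finset.Icc 1 N, Complex.Gammaℂ (s + ((N : ℂ) + 1) / 2 - j)

end

/-! The idea is to compute the law of |det A|² in two ways, for an (n+1)×(n+1) matrix A of
independent standard complex Gaussians.

Expose one row and rotate it onto the first axis. Unitary invariance shows that |det A|² is the
squared length of that row times an independent |det|² of a Gaussian n×n matrix. Iterating, |det A|²
is a product of independent Gamma variables with densities xᵏe⁻ˣ/k!, k = 0, …, n (`detLaw_succ`).

Alternatively, write each row as a length times a direction. The two are independent, the squared
length has density xⁿe⁻ˣ/n!, and the direction is Fubini–Study distributed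
(`map_lengthAndRatio_gaussianVec`). Pulling the lengths out of the determinant leaves ‖det S‖², so
|det A|² is a product of n+1 independent Gamma variables and an independent copy of ‖det S‖²
(`detLaw_eq_gammaProdLaw_mconv_slaterLaw`).

Moments of order s = β(n+1) are multiplicative, hence ∏ₖ Γ(s+k+1)/k! = (Γ(s+n+1)/n!)ⁿ⁺¹ · E‖det
S‖²ˢ. Dividing gives the Gamma quotient. The same identity for absolute moments in [0, ∞] decides
convergence: the factor k = 0 diverges at Re s = -1, where Γ(s+n+1) is still harmless because n ≥ 1.

The functional equation of Γ collapses the quotient to 1/∏ᵢ (s+i)ⁱ, a constant over a polynomial.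
This yields the continuation, the absence of zeros and the pole at s = -1. The zeta integral is, up
to a power of π, the Gaussian moment itself, and the L-factor is the same Gamma product after a
shift. -/

noncomputable section

open Matrix
open scoped ENNReal Nat

/-! ### Product measures and changes of variables -/

/-- The Lebesgue integral of a product of functions of separate variables. -/
theorem lintegral_fin_prod_eq_prod {E : Type*} [MeasurableSpace E] {n : ℕ}
    (μ : Fin n → Measure E) [∀ i, SigmaFinite (μ i)] {f : Fin n → E → ℝ≥0∞}
    (hf : ∀ i, Measurable (f i)) :
    ∫⁻ x, ∏ i, f i (x i) ∂Measure.pi μ = ∏ i, ∫⁻ x, f i x ∂μ i := by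
  induction n with
  | zero => simp
  | succ n ih =>
    have hm : Measurable fun x : Fin (n + 1) → E => ∏ i, f i (x i) := by fun_prop
    rw [← (measurePreserving_piFinSuccAbove μ 0).symm.lintegral_comp hm, Fin.prod_univ_succ]
    simp only [Fin.prod_univ_succ, MeasurableEquiv.piFinSuccAbove_symm_apply,
      Fin.insertNthEquiv_zero, Fin.consEquiv_apply, Fin.cons_zero, Fin.cons_succ]
    rw [← ih (fun i => μ i.succ) fun i => hf i.succ]
    have hm' : Measurable fun y : Fin n → E => ∏ i, f i.succ (y i) :=
      Finset.measurable_prod _ fun i _ => (hf i.succ).comp (measurable_pi_apply i)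
    exact lintegral_prod_mul (hf 0).aemeasurable hm'.aemeasurable

theorem Measure.pi_fin_withDensity {E : Type*} [MeasurableSpace E] {n : ℕ}
    (μ : Measure E) [SigmaFinite μ] {f : E → ℝ≥0∞} (hf : Measurable f)
    [SigmaFinite (μ.withDensity f)] :
    Measure.pi (fun _ : Fin n => μ.withDensity f) =
      (Measure.pi fun _ : Fin n => μ).withDensity fun x => ∏ i, f (x i) := by
  refine Measure.pi_eq fun s hs => ?_
  rw [withDensity_apply _ (MeasurableSet.univ_pi hs), Measure.restrict_pi_pi,
    lintegral_fin_prod_eq_prod _ fun _ => hf]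
  exact Finset.prod_congr rfl fun i _ => (withDensity_apply _ (hs i)).symm

theorem Measure.pi_fin_const_smul {E : Type*} [MeasurableSpace E] {n : ℕ}
    (μ : Measure E) [SigmaFinite μ] (c : ℝ≥0∞) [SigmaFinite (c • μ)] :
    Measure.pi (fun _ : Fin n => c • μ) = c ^ n • Measure.pi fun _ : Fin n => μ := by
  refine Measure.pi_eq fun s _ => ?_
  simp [Measure.pi_pi, Finset.prod_mul_distrib]

/-- A complex linear map scales Lebesgue measure by the squared modulus of its determinant. -/
theorem map_complex_linearMap_volume {n : ℕ} {f : (Fin n → ℂ) →ₗ[ℂ] (Fin n → ℂ)}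
    (hf : LinearMap.det f ≠ 0) :
    Measure.map f (volume : Measure (Fin n → ℂ)) =
      ENNReal.ofReal ((‖LinearMap.det f‖ ^ 2)⁻¹) • volume := by
  have hd : LinearMap.det (f.restrictScalars ℝ) = ‖LinearMap.det f‖ ^ 2 := by
    rw [LinearMap.det_restrictScalars, Algebra.norm_complex_apply, Complex.normSq_eq_norm_sq]
  have h := Measure.map_linearMap_addHaar_eq_smul_addHaar
    (volume : Measure (Fin n → ℂ)) (f := f.restrictScalars ℝ) (by rw [hd]; simpa using hf)
  rw [hd, abs_of_nonneg (by positivity)] at h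
  exact h

theorem lintegral_eq_lintegral_comp_const_smul {n : ℕ} {t : ℂ} (ht : t ≠ 0)
    {F : (Fin n → ℂ) → ℝ≥0∞} (hF : Measurable F) :
    ∫⁻ w, F w = ENNReal.ofReal ((‖t‖ ^ 2) ^ n) * ∫⁻ z, F (t • z) := by
  set f : (Fin n → ℂ) →ₗ[ℂ] (Fin n → ℂ) := t • LinearMap.id
  have hd : LinearMap.det f = t ^ n := by simp [f, LinearMap.det_smul]
  have h := map_complex_linearMap_volume (f := f) (by rw [hd]; exact pow_ne_zero _ ht)
  have h2 : ∫⁻ w, F w ∂(Measure.map f volume) = ∫⁻ z, F (t • z) :=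
    lintegral_map hF f.continuous_of_finiteDimensional.measurable
  have hpos : 0 < (‖t‖ ^ 2) ^ n := by positivity
  rw [← h2, h, hd, lintegral_smul_measure, smul_eq_mul, ← mul_assoc, norm_pow, pow_right_comm _ n 2,
    ← ENNReal.ofReal_mul hpos.le, mul_inv_cancel₀ hpos.ne', ENNReal.ofReal_one, one_mul]

theorem lintegral_Ioi_comp_mul_left {b : ℝ} (hb : 0 < b) (h : ℝ → ℝ≥0∞) :
    ∫⁻ x in Set.Ioi 0, h x = ENNReal.ofReal b * ∫⁻ x in Set.Ioi 0, h (b * x) := by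
  have him : (fun x => b * x) '' Set.Ioi 0 = Set.Ioi 0 := by
    ext y
    constructor
    · rintro ⟨x, hx, rfl⟩
      exact mul_pos hb hx
    · intro hy
      exact ⟨b⁻¹ * y, mul_pos (inv_pos.2 hb) hy, by field_simp⟩
  have := lintegral_image_eq_lintegral_abs_deriv_mul (s := Set.Ioi 0) (f := fun x => b * x)
    (f' := fun _ => b) measurableSet_Ioi
    (fun x _ => by simpa using ((hasDerivAt_id x).const_mul b).hasDerivWithinAt)
    (fun x _ y _ hxy => mul_left_cancel₀ hb.ne' hxy) h
  rw [him, lintegral_const_mul' _ _ ENNReal.ofReal_ne_top, abs_of_pos hb] at this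
  exact this

/-- Under the substitution `x = ‖t‖²`, Lebesgue measure on `ℂ` becomes `π dx` on `(0, ∞)`. -/
theorem lintegral_complex_comp_norm_sq {h : ℝ → ℝ≥0∞} (hh : Measurable h) :
    ∫⁻ t : ℂ, h (‖t‖ ^ 2) = ENNReal.ofReal Real.pi * ∫⁻ x in Set.Ioi 0, h x := by
  have him : (fun x : ℝ => x ^ 2) '' Set.Ioi 0 = Set.Ioi 0 := by
    ext y
    constructor
    · rintro ⟨x, hx, rfl⟩
      exact pow_pos (Set.mem_Ioi.1 hx) 2
    · intro hy
      exact ⟨√y, Real.sqrt_pos.2 hy, Real.sq_sqrt (le_of_lt hy)⟩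
  have hsub := lintegral_image_eq_lintegral_abs_deriv_mul (s := Set.Ioi 0) (f := fun x => x ^ 2)
    (f' := fun x => 2 * x) measurableSet_Ioi
    (fun x _ => by simpa using (hasDerivAt_pow 2 x).hasDerivWithinAt)
    (fun x hx y hy hxy => (pow_left_inj₀ (le_of_lt hx) (le_of_lt hy) two_ne_zero).1 hxy) h
  rw [him] at hsub
  -- The angle contributes 2π and r dr = dx/2, whence the factor π.
  rw [← Complex.lintegral_comp_polarCoord_symm, polarCoord_target, Measure.volume_eq_prod,
    ← Measure.prod_restrict]
  simp only [Complex.norm_polarCoord_symm, sq_abs, smul_eq_mul]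
  rw [lintegral_prod _ (by fun_prop)]
  simp only [lintegral_const, Measure.restrict_apply_univ, Real.volume_Ioo, sub_neg_eq_add]
  rw [hsub, lintegral_mul_const' _ _ ENNReal.ofReal_ne_top,
    ← lintegral_mul_const' _ _ ENNReal.ofReal_ne_top,
    ← lintegral_const_mul' _ _ ENNReal.ofReal_ne_top]
  refine setLIntegral_congr_fun measurableSet_Ioi fun x hx => ?_
  have hx' : (0 : ℝ) < x := hx
  rw [abs_of_pos (by positivity), ← two_mul, ENNReal.ofReal_mul zero_le_two,
    ENNReal.ofReal_mul zero_le_two]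
  ring

/-! ### Gamma laws and their complex moments -/

/-- The Gamma distribution with density `xᵏ e⁻ˣ / k!` on `(0, ∞)`. -/
def gammaLaw (k : ℕ) : Measure ℝ :=
  (volume.restrict (Set.Ioi 0)).withDensity
    fun x => ENNReal.ofReal ((k ! : ℝ)⁻¹ * (x ^ k * Real.exp (-x)))

theorem ae_gammaLaw_pos (k : ℕ) : ∀ᵐ x ∂gammaLaw k, 0 < x :=
  (withDensity_absolutelyContinuous _ _).ae_le (ae_restrict_mem measurableSet_Ioi)

theorem lintegral_gammaLaw (k : ℕ) {f : ℝ → ℝ≥0∞} (hf : Measurable f) :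
    ∫⁻ x, f x ∂gammaLaw k =
      ∫⁻ x in Set.Ioi 0, ENNReal.ofReal ((k ! : ℝ)⁻¹ * (x ^ k * Real.exp (-x))) * f x := by
  rw [gammaLaw, lintegral_withDensity_eq_lintegral_mul _ (by fun_prop) hf]
  rfl

theorem integral_cpow_gammaLaw (k : ℕ) {s : ℂ} (hs : 0 < s.re + k + 1) :
    ∫ x : ℝ, (x : ℂ) ^ s ∂gammaLaw k = (k ! : ℂ)⁻¹ * Complex.Gamma (s + k + 1) := by
  rw [gammaLaw, integral_withDensity_eq_integral_toReal_smul (by fun_prop)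
    (Filter.Eventually.of_forall fun x => ENNReal.ofReal_lt_top),
    Complex.Gamma_eq_integral (by simpa using hs), Complex.GammaIntegral, ← integral_const_mul]
  refine setIntegral_congr_fun measurableSet_Ioi fun x hx => ?_
  have hx : 0 < x := hx
  have hx' : (x : ℂ) ≠ 0 := by exact_mod_cast hx.ne'
  have hnn : 0 ≤ (k ! : ℝ)⁻¹ * (x ^ k * Real.exp (-x)) := by positivity
  simp only [ENNReal.toReal_ofReal hnn, Complex.real_smul]
  rw [show s + k + 1 - 1 = s + k by ring, Complex.cpow_add _ _ hx', Complex.cpow_natCast]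
  push_cast
  ring

theorem enorm_ofReal_cpow_of_pos {x : ℝ} (hx : 0 < x) (s : ℂ) :
    ‖(x : ℂ) ^ s‖ₑ = ENNReal.ofReal (x ^ s.re) := by
  rw [← ofReal_norm, Complex.norm_cpow_eq_rpow_re_of_pos hx]

theorem measurable_ofReal_cpow_const (s : ℂ) : Measurable fun x : ℝ => (x : ℂ) ^ s := by
  fun_prop

theorem lintegral_enorm_cpow_gammaLaw (k : ℕ) (s : ℂ) :
    ∫⁻ x : ℝ, ‖(x : ℂ) ^ s‖ₑ ∂gammaLaw k = ENNReal.ofReal (k ! : ℝ)⁻¹ *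
      ∫⁻ x in Set.Ioi 0, ENNReal.ofReal (Real.exp (-x) * x ^ (s.re + k + 1 - 1)) := by
  rw [lintegral_gammaLaw _ (by fun_prop), ← lintegral_const_mul' _ _ ENNReal.ofReal_ne_top]
  refine setLIntegral_congr_fun measurableSet_Ioi fun x hx => ?_
  have hx : 0 < x := hx
  rw [enorm_ofReal_cpow_of_pos hx, ← ENNReal.ofReal_mul (by positivity),
    ← ENNReal.ofReal_mul (by positivity), show s.re + k + 1 - 1 = s.re + k by ring,
    Real.rpow_add hx, Real.rpow_natCast]
  ring_nf

/-- Needed for arithmetic in [0, ∞]: an infinite factor of a product is visible only if the other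
factors do not vanish. -/
theorem lintegral_enorm_cpow_gammaLaw_ne_zero (k : ℕ) (s : ℂ) :
    ∫⁻ x : ℝ, ‖(x : ℂ) ^ s‖ₑ ∂gammaLaw k ≠ 0 := by
  rw [lintegral_enorm_cpow_gammaLaw]
  refine mul_ne_zero (by simpa using Nat.factorial_ne_zero k) ?_
  rw [← pos_iff_ne_zero, setLIntegral_pos_iff (by fun_prop)]
  refine lt_of_lt_of_le ?_ (measure_mono (s := Set.Ioi 0) fun x hx => ⟨?_, hx⟩)
  · simp
  · have hx : (0 : ℝ) < x := hx
    simp only [Function.mem_support, ne_eq, ENNReal.ofReal_eq_zero, not_le]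
    positivity

theorem lintegral_enorm_cpow_gammaLaw_ne_top (k : ℕ) {s : ℂ} (hs : 0 < s.re + k + 1) :
    ∫⁻ x : ℝ, ‖(x : ℂ) ^ s‖ₑ ∂gammaLaw k ≠ ∞ := by
  rw [lintegral_enorm_cpow_gammaLaw]
  refine ENNReal.mul_ne_top ENNReal.ofReal_ne_top ?_
  have h := (Real.GammaIntegral_convergent hs).hasFiniteIntegral
  rw [hasFiniteIntegral_iff_ofReal] at h
  · exact h.ne
  · filter_upwards [ae_restrict_mem measurableSet_Ioi] with x hx
    have hx : 0 < x := hx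
    positivity

/-- On (0, 1) the exponential is at least e⁻¹, so convergence would make the bare power integrable
at 0. -/
theorem lintegral_enorm_cpow_gammaLaw_eq_top (k : ℕ) {s : ℂ} (hs : s.re + k + 1 ≤ 0) :
    ∫⁻ x : ℝ, ‖(x : ℂ) ^ s‖ₑ ∂gammaLaw k = ∞ := by
  rw [lintegral_enorm_cpow_gammaLaw, ENNReal.mul_eq_top]
  refine Or.inl ⟨by simpa using Nat.factorial_ne_zero k, ?_⟩
  by_contra hfin
  have hnot : ¬ IntegrableOn (fun x : ℝ => x ^ (s.re + k + 1 - 1)) (Set.Ioo 0 1) volume := by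
    rw [intervalIntegral.integrableOn_Ioo_rpow_iff one_pos]
    linarith
  refine hnot ⟨by fun_prop, ?_⟩
  rw [hasFiniteIntegral_iff_ofReal]
  swap
  · filter_upwards [ae_restrict_mem measurableSet_Ioo] with x hx
    have hx : 0 < x := hx.1
    positivity
  calc ∫⁻ x in Set.Ioo (0 : ℝ) 1, ENNReal.ofReal (x ^ (s.re + k + 1 - 1))
      ≤ ∫⁻ x in Set.Ioo (0 : ℝ) 1, ENNReal.ofReal (Real.exp 1) *
          ENNReal.ofReal (Real.exp (-x) * x ^ (s.re + k + 1 - 1)) := by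
        refine setLIntegral_mono (by fun_prop) fun x hx => ?_
        rw [← ENNReal.ofReal_mul (Real.exp_nonneg _), ← mul_assoc, ← Real.exp_add]
        refine ENNReal.ofReal_le_ofReal (le_mul_of_one_le_left ?_ ?_)
        · exact Real.rpow_nonneg hx.1.le _
        · exact Real.one_le_exp (by linarith [hx.2])
    _ ≤ ENNReal.ofReal (Real.exp 1) *
          ∫⁻ x in Set.Ioi (0 : ℝ), ENNReal.ofReal (Real.exp (-x) * x ^ (s.re + k + 1 - 1)) := by
        rw [lintegral_const_mul' _ _ ENNReal.ofReal_ne_top]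
        gcongr
        exact Set.Ioo_subset_Ioi_self
    _ < ∞ := ENNReal.mul_lt_top ENNReal.ofReal_lt_top (lt_top_iff_ne_top.2 hfin)

instance gammaLaw.instIsProbabilityMeasure (k : ℕ) : IsProbabilityMeasure (gammaLaw k) := by
  have h0 := lintegral_enorm_cpow_gammaLaw_ne_top k (s := 0) (by simp; positivity)
  have hfin : IsFiniteMeasure (gammaLaw k) := ⟨by simpa [lt_top_iff_ne_top] using h0⟩
  have h1 := integral_cpow_gammaLaw k (s := 0) (by simp; positivity)
  rw [zero_add, Complex.Gamma_nat_eq_factorial,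
    inv_mul_cancel₀ (by exact_mod_cast Nat.factorial_ne_zero k)] at h1
  simp only [Complex.cpow_zero, integral_const, Complex.real_smul, mul_one] at h1
  constructor
  have h2 : (gammaLaw k).real Set.univ = 1 := by exact_mod_cast h1
  rw [Measure.real] at h2
  rw [← ENNReal.ofReal_toReal (measure_ne_top (gammaLaw k) Set.univ), h2, ENNReal.ofReal_one]

/-! ### Gaussian vectors: independence of length and direction -/

/-- The standard complex Gaussian distribution. -/
def complexGaussian : Measure ℂ :=
  volume.withDensity fun z => ENNReal.ofReal (Real.pi⁻¹ * Real.exp (-‖z‖ ^ 2))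

instance complexGaussian.instIsProbabilityMeasure : IsProbabilityMeasure complexGaussian := by
  constructor
  have h1 := measure_univ (μ := gammaLaw 0)
  rw [gammaLaw, withDensity_apply _ MeasurableSet.univ, Measure.restrict_univ] at h1
  rw [complexGaussian, withDensity_apply _ MeasurableSet.univ, Measure.restrict_univ,
    lintegral_complex_comp_norm_sq (h := fun x => ENNReal.ofReal (Real.pi⁻¹ * Real.exp (-x)))
      (by fun_prop)]
  simp only [ENNReal.ofReal_mul (inv_nonneg.2 Real.pi_nonneg)]
  rw [lintegral_const_mul' _ _ ENNReal.ofReal_ne_top, ← mul_assoc,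
    ← ENNReal.ofReal_mul Real.pi_nonneg, mul_inv_cancel₀ Real.pi_ne_zero]
  simpa using h1

/-- The distribution of a vector of independent standard complex Gaussians. -/
def gaussianVec (N : ℕ) : Measure (Fin N → ℂ) := Measure.pi fun _ => complexGaussian

instance gaussianVec.instIsProbabilityMeasure (N : ℕ) : IsProbabilityMeasure (gaussianVec N) := by
  unfold gaussianVec; infer_instance

theorem gaussianVec_eq_withDensity (N : ℕ) :
    gaussianVec N = volume.withDensity fun z =>
      ENNReal.ofReal (Real.pi⁻¹ ^ N * Real.exp (-∑ i, ‖z i‖ ^ 2)) := by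
  have : SigmaFinite ((volume : Measure ℂ).withDensity
      fun z => ENNReal.ofReal (Real.pi⁻¹ * Real.exp (-‖z‖ ^ 2))) :=
    inferInstanceAs (SigmaFinite complexGaussian)
  rw [gaussianVec]
  unfold complexGaussian
  rw [Measure.pi_fin_withDensity volume (by fun_prop), volume_pi]
  congr 1
  ext z
  rw [← ENNReal.ofReal_prod_of_nonneg fun i _ => by positivity, Finset.prod_mul_distrib,
    ← Real.exp_sum]
  simp

/-- The Fubini–Study volume form in the affine chart, normalized to have total mass one. -/
def fsAffine (n : ℕ) : Measure (Fin n → ℂ) :=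
  volume.withDensity fun z =>
    ENNReal.ofReal (n ! * Real.pi⁻¹ ^ n * ((1 + ∑ i, ‖z i‖ ^ 2) ^ (n + 1))⁻¹)

/-- The squared length and the affine coordinates of a vector of `ℂⁿ⁺¹`. -/
def lengthAndRatio (n : ℕ) (a : Fin (n + 1) → ℂ) : ℝ × (Fin n → ℂ) :=
  (∑ i, ‖a i‖ ^ 2, fun i => a i.succ / a 0)

@[fun_prop]
theorem measurable_lengthAndRatio (n : ℕ) : Measurable (lengthAndRatio n) := by
  unfold lengthAndRatio; fun_prop

theorem lengthAndRatio_cons_smul {n : ℕ} {t : ℂ} (ht : t ≠ 0) (z : Fin n → ℂ) :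
    lengthAndRatio n (Fin.cons t (t • z)) = (‖t‖ ^ 2 * (1 + ∑ i, ‖z i‖ ^ 2), z) := by
  unfold lengthAndRatio
  congr 1
  · simp [Fin.sum_univ_succ, mul_pow, Finset.mul_sum, mul_add]
  · ext i
    simp [ht]

/-- The squared length and the direction of a Gaussian vector are independent; the first is Gamma
distributed and the second has the Fubini–Study distribution. -/
theorem map_lengthAndRatio_gaussianVec (n : ℕ) :
    (gaussianVec (n + 1)).map (lengthAndRatio n) = (gammaLaw n).prod (fsAffine n) := by
  have hsf : SFinite (fsAffine n) := by unfold fsAffine; infer_instance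
  refine Measure.ext_of_lintegral _ fun F hF => ?_
  set q : (Fin n → ℂ) → ℝ := fun z => 1 + ∑ i, ‖z i‖ ^ 2 with hq
  have hqm : Measurable q := by fun_prop
  have hqpos : ∀ z, 0 < q z := fun z => by positivity
  -- The integrand after writing the vector as (t, t • z), with x = ‖t‖²: the Jacobian of w = t • z
  -- is ‖t‖²ⁿ = xⁿ, and the squared length is x · q z.
  set K : ℝ → (Fin n → ℂ) → ℝ≥0∞ := fun x z => ENNReal.ofReal (x ^ n) *
    (ENNReal.ofReal (Real.pi⁻¹ ^ (n + 1) * Real.exp (-(x * q z))) * F (x * q z, z)) with hK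
  have hKm : Measurable (Function.uncurry K) := by
    simp only [hK, Function.uncurry_def]; fun_prop
  have hleft : ∫⁻ p, F p ∂(gaussianVec (n + 1)).map (lengthAndRatio n) =
      ∫⁻ t : ℂ, ∫⁻ z, K (‖t‖ ^ 2) z := by
    rw [lintegral_map hF (by fun_prop), gaussianVec_eq_withDensity,
      lintegral_withDensity_eq_lintegral_mul _ (by fun_prop) (by fun_prop),
      ← (volume_preserving_piFinSuccAbove (fun _ : Fin (n + 1) => ℂ) 0).symm.lintegral_comp
        (by fun_prop), Measure.volume_eq_prod, lintegral_prod _ (by fun_prop)]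
    refine lintegral_congr_ae ?_
    filter_upwards [Measure.ae_ne volume (0 : ℂ)] with t ht
    rw [lintegral_eq_lintegral_comp_const_smul ht (by fun_prop),
      ← lintegral_const_mul' _ _ ENNReal.ofReal_ne_top]
    refine lintegral_congr fun z => ?_
    have h1 := lengthAndRatio_cons_smul ht z
    have h2 := congrArg Prod.fst h1
    simp only [lengthAndRatio] at h2
    have h3 : (MeasurableEquiv.piFinSuccAbove (fun _ : Fin (n + 1) => ℂ) 0).symm (t, t • z) =
        Fin.cons t (t • z) := by
      rw [MeasurableEquiv.piFinSuccAbove_symm_apply, Fin.insertNthEquiv_zero]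
      rfl
    simp only [hK, Pi.mul_apply, h3, h1, h2, hq]
  have hright : ∫⁻ p, F p ∂(gammaLaw n).prod (fsAffine n) =
      ∫⁻ z, ENNReal.ofReal (n ! * Real.pi⁻¹ ^ n * ((q z) ^ (n + 1))⁻¹) *
        ∫⁻ x in Set.Ioi 0, ENNReal.ofReal ((n ! : ℝ)⁻¹ * (x ^ n * Real.exp (-x))) * F (x, z) := by
    rw [lintegral_prod_symm' _ hF, fsAffine,
      lintegral_withDensity_eq_lintegral_mul _ (by fun_prop) hF.lintegral_prod_left']
    refine lintegral_congr fun z => ?_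
    simp only [Pi.mul_apply]
    rw [lintegral_gammaLaw _ (by fun_prop)]
  rw [hleft, hright, lintegral_lintegral_swap (by fun_prop)]
  refine lintegral_congr fun z => ?_
  -- For fixed z, rescaling x by q z on the Gamma side produces (q z)ⁿ⁺¹, which cancels the
  -- Fubini–Study density; the remaining powers of π match through the π of polar coordinates.
  rw [lintegral_complex_comp_norm_sq (h := fun x => K x z) (by fun_prop),
    lintegral_Ioi_comp_mul_left (hqpos z) fun x =>
      ENNReal.ofReal ((n ! : ℝ)⁻¹ * (x ^ n * Real.exp (-x))) * F (x, z), ← mul_assoc _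
    (ENNReal.ofReal (q z)), ← ENNReal.ofReal_mul (by positivity),
    ← lintegral_const_mul' _ _ ENNReal.ofReal_ne_top,
    ← lintegral_const_mul' _ _ ENNReal.ofReal_ne_top]
  refine setLIntegral_congr_fun measurableSet_Ioi fun x hx => ?_
  have hx : 0 < x := hx
  have := hqpos z
  have hfac : (n ! : ℝ) ≠ 0 := by exact_mod_cast Nat.factorial_ne_zero n
  simp only [hK]
  rw [← mul_assoc, ← mul_assoc, ← mul_assoc, ← ENNReal.ofReal_mul (by positivity),
    ← ENNReal.ofReal_mul (by positivity), ← ENNReal.ofReal_mul (by positivity),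
    mul_comm (q z) x]
  congr 2
  rw [mul_pow, pow_succ, pow_succ]
  field_simp

/-- The total mass is read off from the factorization of the Gaussian probability measure, so no
separate integral has to be computed. -/
instance fsAffine.instIsProbabilityMeasure (n : ℕ) : IsProbabilityMeasure (fsAffine n) := by
  have hsf : SFinite (fsAffine n) := by unfold fsAffine; infer_instance
  have h := congrArg (fun μ => μ Set.univ) (map_lengthAndRatio_gaussianVec n)
  simp only [Measure.map_apply (measurable_lengthAndRatio n) MeasurableSet.univ,
    Set.preimage_univ, measure_univ] at h
  rw [← Set.univ_prod_univ, Measure.prod_prod, measure_univ, one_mul] at h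
  exact ⟨h.symm⟩

theorem map_length_gaussianVec (n : ℕ) :
    (gaussianVec (n + 1)).map (fun a => ∑ i, ‖a i‖ ^ 2) = gammaLaw n := by
  have h := congrArg (Measure.map Prod.fst) (map_lengthAndRatio_gaussianVec n)
  rw [Measure.map_map (by fun_prop) (by fun_prop), measurePreserving_fst.map_eq] at h
  exact h

/-! ### Unitary invariance and the Gaussian determinant -/

theorem norm_det_of_mem_unitaryGroup {N : ℕ} {U : Matrix (Fin N) (Fin N) ℂ}
    (hU : U ∈ unitaryGroup (Fin N) ℂ) : ‖U.det‖ = 1 :=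
  CStarRing.norm_of_mem_unitary (det_of_mem_unitary hU)

theorem sum_norm_sq_vecMul_of_mem_unitaryGroup {N : ℕ} {U : Matrix (Fin N) (Fin N) ℂ}
    (hU : U ∈ unitaryGroup (Fin N) ℂ) (v : Fin N → ℂ) :
    ∑ i, ‖(v ᵥ* U) i‖ ^ 2 = ∑ i, ‖v i‖ ^ 2 := by
  have key : ∀ w : Fin N → ℂ, ((∑ i, ‖w i‖ ^ 2 : ℝ) : ℂ) = w ⬝ᵥ star w := by
    intro w
    simp [dotProduct, Complex.mul_conj, Complex.normSq_eq_norm_sq]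
  have h : (v ᵥ* U) ⬝ᵥ star (v ᵥ* U) = v ⬝ᵥ star v := by
    rw [star_vecMul, ← dotProduct_mulVec, mulVec_mulVec, ← star_eq_conjTranspose,
      mem_unitaryGroup_iff.1 hU, one_mulVec]
  exact_mod_cast (key _).trans (h.trans (key _).symm)

/-- A unitary map preserves Lebesgue measure, as |det U| = 1, and the Gaussian density depends only
on the length. -/
theorem measurePreserving_vecMul_gaussianVec {N : ℕ} {U : Matrix (Fin N) (Fin N) ℂ}
    (hU : U ∈ unitaryGroup (Fin N) ℂ) :
    MeasurePreserving (fun v => v ᵥ* U) (gaussianVec N) (gaussianVec N) := by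
  have hfun : ⇑(Matrix.toLin' Uᵀ) = fun v => v ᵥ* U := by
    ext v
    simp [mulVec_transpose]
  have hm : Measurable fun v : Fin N → ℂ => v ᵥ* U :=
    hfun ▸ (Matrix.toLin' Uᵀ).continuous_of_finiteDimensional.measurable
  refine ⟨hm, Measure.ext_of_lintegral _ fun F hF => ?_⟩
  have hdet : LinearMap.det (Matrix.toLin' Uᵀ) = U.det := by simp
  have hvol := map_complex_linearMap_volume (f := Matrix.toLin' Uᵀ) (by
    rw [hdet, ← norm_ne_zero_iff, norm_det_of_mem_unitaryGroup hU]; exact one_ne_zero)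
  rw [hdet, norm_det_of_mem_unitaryGroup hU] at hvol
  simp only [one_pow, inv_one, ENNReal.ofReal_one, one_smul] at hvol
  rw [hfun] at hvol
  have hG : Measurable fun v : Fin N → ℂ =>
    ENNReal.ofReal (Real.pi⁻¹ ^ N * Real.exp (-∑ i, ‖v i‖ ^ 2)) := by fun_prop
  rw [lintegral_map hF hm, gaussianVec_eq_withDensity,
    lintegral_withDensity_eq_lintegral_mul _ hG (g := fun v => F (v ᵥ* U)) (hF.comp hm),
    lintegral_withDensity_eq_lintegral_mul _ hG hF]
  conv_rhs => rw [← hvol]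
  rw [lintegral_map (hG.mul hF) hm]
  simp only [Pi.mul_apply, sum_norm_sq_vecMul_of_mem_unitaryGroup hU]

/-- Every vector can be rotated onto the first coordinate axis. -/
theorem exists_unitary_vecMul_eq_single {N : ℕ} (a : Fin (N + 1) → ℂ) (ha : a ≠ 0) :
    ∃ U ∈ unitaryGroup (Fin (N + 1)) ℂ,
      a ᵥ* U = Pi.single 0 ((√(∑ i, ‖a i‖ ^ 2) : ℝ) : ℂ) := by
  set v : EuclideanSpace ℂ (Fin (N + 1)) := WithLp.toLp 2 a with hv
  have hnorm : ‖v‖ = √(∑ i, ‖a i‖ ^ 2) := EuclideanSpace.norm_eq v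
  have hv0 : v ≠ 0 := by simpa [hv] using ha
  have hvn : (‖v‖ : ℂ) ≠ 0 := by simpa using hv0
  have horth : Orthonormal ℂ (({0} : Set (Fin (N + 1))).domRestrict
      fun _ => (‖v‖ : ℂ)⁻¹ • v) := by
    constructor
    · intro i
      simp [norm_smul, hv0]
    · intro i j hij
      exact absurd (Subsingleton.elim i j) hij
  obtain ⟨b, hb⟩ := horth.exists_orthonormalBasis_extension_of_card_eq (by simp)
  have hb0 : v = (‖v‖ : ℂ) • b 0 := by
    rw [hb 0 rfl, smul_smul, mul_inv_cancel₀ hvn, one_smul]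
  -- With conjugated basis vectors as columns, the j-th entry of a U is the inner product of b j
  -- with a. It vanishes for j ≠ 0 because a is a multiple of b 0.
  refine ⟨Matrix.of fun i j => star (b j i), ?_, ?_⟩
  · rw [mem_unitaryGroup_iff']
    ext j k
    have := orthonormal_iff_ite.1 b.orthonormal k j
    rw [PiLp.inner_apply] at this
    simp only [RCLike.inner_apply] at this
    rw [star_eq_conjTranspose, mul_apply, one_apply]
    simp only [conjTranspose_apply, of_apply, star_star]
    rw [show (∑ x, (b j) x * star ((b k) x)) = if k = j then 1 else 0 from this]
    simp [eq_comm]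
  · ext j
    have h1 : inner ℂ (b j) v = if j = 0 then (‖v‖ : ℂ) else 0 := by
      conv_lhs => rw [hb0]
      rw [inner_smul_right, orthonormal_iff_ite.1 b.orthonormal j 0]
      split_ifs <;> simp
    rw [PiLp.inner_apply] at h1
    simp only [RCLike.inner_apply] at h1
    rw [← hnorm, vecMul, dotProduct, Pi.single_apply, ← h1]
    rfl

theorem measurePreserving_tail_gaussianVec (N : ℕ) :
    MeasurePreserving (fun (v : Fin (N + 1) → ℂ) (j : Fin N) => v j.succ)
      (gaussianVec (N + 1)) (gaussianVec N) :=
  measurePreserving_snd.comp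
    (measurePreserving_piFinSuccAbove (fun _ : Fin (N + 1) => complexGaussian) 0)

/-- The distribution of `|det A|²` for a matrix `A` of independent standard complex Gaussians. -/
def detLaw (N : ℕ) : Measure ℝ :=
  (Measure.pi fun _ : Fin N => gaussianVec N).map fun A => ‖(Matrix.of A).det‖ ^ 2

@[fun_prop]
theorem measurable_norm_det_sq (N : ℕ) :
    Measurable fun A : Fin N → Fin N → ℂ => ‖(Matrix.of A).det‖ ^ 2 := by
  have : Continuous fun A : Fin N → Fin N → ℂ => (Matrix.of A).det :=
    Continuous.matrix_det continuous_id
  exact (this.norm.pow 2).measurable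

instance detLaw.instIsProbabilityMeasure (N : ℕ) : IsProbabilityMeasure (detLaw N) :=
  Measure.isProbabilityMeasure_map (measurable_norm_det_sq N).aemeasurable

theorem ae_detLaw_nonneg (N : ℕ) : ∀ᵐ x ∂detLaw N, 0 ≤ x := by
  rw [detLaw, ae_map_iff (measurable_norm_det_sq N).aemeasurable measurableSet_Ici]
  exact Filter.Eventually.of_forall fun _ => by positivity

theorem det_of_cons_single {N : ℕ} (c : ℂ) (B : Fin N → Fin (N + 1) → ℂ) :
    (Matrix.of (Fin.cons (Pi.single 0 c) B : Fin (N + 1) → Fin (N + 1) → ℂ)).det =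
      c * (Matrix.of fun i j => B i j.succ).det := by
  rw [det_succ_row_zero, Fin.sum_univ_succ]
  simp only [of_apply, Fin.cons_zero, Pi.single_apply, Fin.succ_ne_zero, if_true, if_false,
    Fin.val_zero, pow_zero, one_mul, mul_zero, zero_mul, Finset.sum_const_zero, add_zero]
  rfl

/-- Right multiplication by a unitary U taking a to (|a|, 0, …, 0) keeps |det|. Expansion along the
first row leaves |a| times the minor formed by the tails of the rows B i U, which are again
independent Gaussian vectors. -/
theorem lintegral_norm_det_cons {N : ℕ} {a : Fin (N + 1) → ℂ} (ha : a ≠ 0)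
    {g : ℝ → ℝ≥0∞} (hg : Measurable g) :
    ∫⁻ B, g (‖(Matrix.of (Fin.cons a B : Fin (N + 1) → Fin (N + 1) → ℂ)).det‖ ^ 2)
      ∂(Measure.pi fun _ : Fin N => gaussianVec (N + 1)) =
    ∫⁻ y, g ((∑ i, ‖a i‖ ^ 2) * y) ∂detLaw N := by
  obtain ⟨U, hU, hUa⟩ := exists_unitary_vecMul_eq_single a ha
  have hdet : ∀ B : Fin N → Fin (N + 1) → ℂ,
      ‖(Matrix.of (Fin.cons a B : Fin (N + 1) → Fin (N + 1) → ℂ)).det‖ ^ 2 =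
        (∑ i, ‖a i‖ ^ 2) * ‖(Matrix.of fun i j => (B i ᵥ* U) (Fin.succ j)).det‖ ^ 2 := by
    intro B
    have h1 : Matrix.of (Fin.cons a B : Fin (N + 1) → Fin (N + 1) → ℂ) * U =
        Matrix.of (Fin.cons (Pi.single 0 ((√(∑ i, ‖a i‖ ^ 2) : ℝ) : ℂ)) fun i => B i ᵥ* U :
          Fin (N + 1) → Fin (N + 1) → ℂ) := by
      ext i j
      rw [mul_apply_eq_vecMul]
      refine Fin.cases ?_ (fun i => ?_) i
      · simp [← hUa]
        rfl
      · rfl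
    have h2 := congrArg (fun M => ‖M.det‖ ^ 2) h1
    simp only [det_mul, norm_mul, norm_det_of_mem_unitaryGroup hU, mul_one] at h2
    rw [h2, det_of_cons_single, norm_mul, mul_pow, Complex.norm_real, Real.norm_eq_abs, sq_abs,
      Real.sq_sqrt (by positivity)]
  simp only [hdet]
  have hmp := measurePreserving_pi (fun _ : Fin N => gaussianVec (N + 1))
    (fun _ : Fin N => gaussianVec N) fun _ =>
      (measurePreserving_tail_gaussianVec N).comp (measurePreserving_vecMul_gaussianVec hU)
  rw [detLaw, lintegral_map (by fun_prop) (by fun_prop), ← hmp.lintegral_comp (by fun_prop)]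
  rfl

/-- The squared modulus of a Gaussian determinant is a product of independent Gamma variables. -/
theorem detLaw_succ (N : ℕ) : detLaw (N + 1) = gammaLaw N ∗ₘ detLaw N := by
  refine Measure.ext_of_lintegral _ fun g hg => ?_
  have hne : ∀ᵐ a ∂gaussianVec (N + 1), a ≠ 0 := by
    rw [gaussianVec_eq_withDensity]
    exact (withDensity_absolutelyContinuous _ _).ae_le (Measure.ae_ne volume 0)
  have hcons : ∀ p : (Fin (N + 1) → ℂ) × (Fin N → Fin (N + 1) → ℂ),
      (MeasurableEquiv.piFinSuccAbove (fun _ : Fin (N + 1) => Fin (N + 1) → ℂ) 0).symm p =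
        Fin.cons p.1 p.2 := by
    intro p
    rw [MeasurableEquiv.piFinSuccAbove_symm_apply, Fin.insertNthEquiv_zero]
    rfl
  rw [Measure.lintegral_mconv hg, ← map_length_gaussianVec, lintegral_map (by fun_prop)
    (by fun_prop), detLaw, lintegral_map hg (by fun_prop),
    ← (measurePreserving_piFinSuccAbove
      (fun _ : Fin (N + 1) => gaussianVec (N + 1)) 0).symm.lintegral_comp (by fun_prop),
    lintegral_prod]
  · refine lintegral_congr_ae ?_
    filter_upwards [hne] with a ha
    simp only [hcons]
    exact lintegral_norm_det_cons ha hg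
  · exact ((hg.comp (measurable_norm_det_sq (N + 1))).comp
      (MeasurableEquiv.measurable _)).aemeasurable

/-! ### The Slater determinant inside the Gaussian determinant -/

/-- The squared Fubini–Study norm of the Slater determinant of the homogeneous coordinates, in the
affine chart. -/
def slaterSq (n : ℕ) (z : Fin (n + 1) → Fin n → ℂ) : ℝ :=
  ‖(Matrix.of fun j => (Fin.cons 1 (z j) : Fin (n + 1) → ℂ)).det‖ ^ 2 /
    ∏ j, (1 + ∑ i, ‖z j i‖ ^ 2)

@[fun_prop]
theorem measurable_slaterSq (n : ℕ) : Measurable (slaterSq n) := by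
  have hc : Measurable fun (z : Fin (n + 1) → Fin n → ℂ) (j : Fin (n + 1)) =>
      (Fin.cons 1 (z j) : Fin (n + 1) → ℂ) := by
    refine measurable_pi_lambda _ fun j => measurable_pi_lambda _ fun i => ?_
    refine Fin.cases ?_ (fun i => ?_) i
    · simp
    · simp only [Fin.cons_succ]
      fun_prop
  exact ((measurable_norm_det_sq (n + 1)).comp hc).div (by fun_prop)

theorem slaterSq_nonneg (n : ℕ) (z : Fin (n + 1) → Fin n → ℂ) : 0 ≤ slaterSq n z := by
  unfold slaterSq; positivity

theorem norm_det_sq_eq_prod_mul_slaterSq {n : ℕ} {A : Fin (n + 1) → Fin (n + 1) → ℂ}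
    (hA : ∀ j, A j 0 ≠ 0) :
    ‖(Matrix.of A).det‖ ^ 2 =
      (∏ j, (lengthAndRatio n (A j)).1) * slaterSq n fun j => (lengthAndRatio n (A j)).2 := by
  set z : Fin (n + 1) → Fin n → ℂ := fun j => (lengthAndRatio n (A j)).2 with hz
  have hrow : ∀ j, A j = Fin.cons (A j 0) (A j 0 • z j) := by
    intro j
    ext i
    refine Fin.cases rfl (fun i => ?_) i
    simp [hz, lengthAndRatio, mul_div_cancel₀ _ (hA j)]
  have hlen : ∀ j, (lengthAndRatio n (A j)).1 = ‖A j 0‖ ^ 2 * (1 + ∑ i, ‖z j i‖ ^ 2) := by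
    intro j
    conv_lhs => rw [hrow j]
    rw [lengthAndRatio_cons_smul (hA j)]
  have hmat : Matrix.of A = Matrix.of fun j i =>
      A j 0 * (Matrix.of fun j => (Fin.cons 1 (z j) : Fin (n + 1) → ℂ)) j i := by
    ext j i
    rw [of_apply, hrow j]
    refine Fin.cases ?_ (fun i => ?_) i <;> simp
  have hpos : ∏ j, (1 + ∑ i, ‖z j i‖ ^ 2) ≠ 0 :=
    Finset.prod_ne_zero_iff.2 fun j _ => by positivity
  simp only [hlen]
  rw [hmat, det_mul_column, norm_mul, norm_prod, mul_pow, slaterSq, Finset.prod_mul_distrib,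
    Finset.prod_pow]
  field_simp

theorem ae_pi_gaussianVec_ne_zero (n : ℕ) :
    ∀ᵐ A ∂(Measure.pi fun _ : Fin (n + 1) => gaussianVec (n + 1)), ∀ j, A j 0 ≠ 0 := by
  have h0 : ∀ᵐ z ∂complexGaussian, z ≠ 0 :=
    (withDensity_absolutelyContinuous _ _).ae_le (Measure.ae_ne volume 0)
  have h1 : ∀ᵐ a ∂gaussianVec (n + 1), a 0 ≠ 0 :=
    (Measure.quasiMeasurePreserving_eval (fun _ : Fin (n + 1) => complexGaussian) 0).ae h0
  exact ae_all_iff.2 fun j =>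
    (Measure.quasiMeasurePreserving_eval (fun _ : Fin (n + 1) => gaussianVec (n + 1)) j).ae h1

/-- The distribution of the squared norm of the Slater determinant. -/
def slaterLaw (n : ℕ) : Measure ℝ :=
  (Measure.pi fun _ : Fin (n + 1) => fsAffine n).map (slaterSq n)

instance slaterLaw.instIsProbabilityMeasure (n : ℕ) : IsProbabilityMeasure (slaterLaw n) :=
  Measure.isProbabilityMeasure_map (measurable_slaterSq n).aemeasurable

theorem ae_slaterLaw_nonneg (n : ℕ) : ∀ᵐ x ∂slaterLaw n, 0 ≤ x := by
  rw [slaterLaw, ae_map_iff (measurable_slaterSq n).aemeasurable measurableSet_Ici]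
  exact Filter.Eventually.of_forall (slaterSq_nonneg n)

/-- The distribution of a product of independent variables `x₁, …, x_N` with law `gammaLaw k`. -/
def gammaProdLaw (k N : ℕ) : Measure ℝ :=
  (Measure.pi fun _ : Fin N => gammaLaw k).map fun x => ∏ j, x j

instance gammaProdLaw.instIsProbabilityMeasure (k N : ℕ) :
    IsProbabilityMeasure (gammaProdLaw k N) :=
  Measure.isProbabilityMeasure_map (by fun_prop)

theorem ae_pi_gammaLaw_pos (k N : ℕ) :
    ∀ᵐ x ∂(Measure.pi fun _ : Fin N => gammaLaw k), ∀ j, 0 < x j :=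
  ae_all_iff.2 fun j => (Measure.quasiMeasurePreserving_eval (fun _ : Fin N => gammaLaw k) j).ae
    (ae_gammaLaw_pos k)

theorem ae_gammaProdLaw_nonneg (k N : ℕ) : ∀ᵐ x ∂gammaProdLaw k N, 0 ≤ x := by
  rw [gammaProdLaw, ae_map_iff (by fun_prop) measurableSet_Ici]
  filter_upwards [ae_pi_gammaLaw_pos k N] with x hx
  exact Finset.prod_nonneg fun j _ => (hx j).le

/-- Splitting off the lengths of the rows of a Gaussian matrix. -/
theorem detLaw_eq_gammaProdLaw_mconv_slaterLaw (n : ℕ) :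
    detLaw (n + 1) = gammaProdLaw n (n + 1) ∗ₘ slaterLaw n := by
  -- Each row is sent to its length and ratios, and then all lengths are separated from all ratios;
  -- the image of the Gaussian law is a product measure.
  have hmp := (measurePreserving_arrowProdEquivProdArrow ℝ (Fin n → ℂ) (Fin (n + 1))
    (fun _ => gammaLaw n) fun _ => fsAffine n).comp
    (measurePreserving_pi (fun _ : Fin (n + 1) => gaussianVec (n + 1))
      (fun _ : Fin (n + 1) => (gammaLaw n).prod (fsAffine n)) fun _ =>
      ⟨measurable_lengthAndRatio n, map_lengthAndRatio_gaussianVec n⟩)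
  refine Measure.ext_of_lintegral _ fun g hg => ?_
  rw [Measure.mconv, gammaProdLaw, slaterLaw, Measure.map_prod_map _ _ (by fun_prop) (by fun_prop),
    lintegral_map hg (by fun_prop), lintegral_map (by fun_prop) (by fun_prop),
    ← hmp.lintegral_comp (by fun_prop), detLaw, lintegral_map hg (by fun_prop)]
  refine lintegral_congr_ae ?_
  filter_upwards [ae_pi_gaussianVec_ne_zero n] with A hA
  rw [norm_det_sq_eq_prod_mul_slaterSq hA]
  rfl

/-! ### Multiplicativity of moments and the range of convergence -/

/-- The absolute moment of complex order `s` of a measure on the line. -/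
def absMoment (μ : Measure ℝ) (s : ℂ) : ℝ≥0∞ := ∫⁻ x, ‖(x : ℂ) ^ s‖ₑ ∂μ

/-- The moment of complex order `s` of a measure on the line. -/
def powMoment (μ : Measure ℝ) (s : ℂ) : ℂ := ∫ x, (x : ℂ) ^ s ∂μ

theorem integrable_cpow_iff (μ : Measure ℝ) (s : ℂ) :
    Integrable (fun x : ℝ => (x : ℂ) ^ s) μ ↔ absMoment μ s ≠ ∞ := by
  rw [absMoment, ← lt_top_iff_ne_top]
  exact ⟨fun h => h.2, fun h => ⟨(measurable_ofReal_cpow_const s).aestronglyMeasurable, h⟩⟩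

theorem ae_prod_cpow_mul {μ ν : Measure ℝ} [SFinite μ] [SFinite ν] (hμ : ∀ᵐ x ∂μ, 0 ≤ x)
    (hν : ∀ᵐ x ∂ν, 0 ≤ x) (s : ℂ) :
    ∀ᵐ p ∂μ.prod ν, ((p.1 * p.2 : ℝ) : ℂ) ^ s = (p.1 : ℂ) ^ s * (p.2 : ℂ) ^ s := by
  filter_upwards [Measure.quasiMeasurePreserving_fst.ae hμ,
    Measure.quasiMeasurePreserving_snd.ae hν] with p h1 h2
  rw [Complex.ofReal_mul, Complex.mul_cpow_ofReal_nonneg h1 h2]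

theorem absMoment_mconv {μ ν : Measure ℝ} [SFinite μ] [SFinite ν] (hμ : ∀ᵐ x ∂μ, 0 ≤ x)
    (hν : ∀ᵐ x ∂ν, 0 ≤ x) (s : ℂ) :
    absMoment (μ ∗ₘ ν) s = absMoment μ s * absMoment ν s := by
  rw [absMoment, Measure.mconv, lintegral_map (by fun_prop) (by fun_prop), absMoment, absMoment,
    ← lintegral_prod_mul (by fun_prop) (by fun_prop)]
  refine lintegral_congr_ae ?_
  filter_upwards [ae_prod_cpow_mul hμ hν s] with p hp
  rw [hp, enorm_mul]

/-- No integrability is required: the product formula for Bochner integrals holds with the default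
value 0 as well. -/
theorem powMoment_mconv {μ ν : Measure ℝ} [SFinite μ] [SFinite ν] (hμ : ∀ᵐ x ∂μ, 0 ≤ x)
    (hν : ∀ᵐ x ∂ν, 0 ≤ x) (s : ℂ) :
    powMoment (μ ∗ₘ ν) s = powMoment μ s * powMoment ν s := by
  rw [powMoment, Measure.mconv, integral_map (by fun_prop)
    (measurable_ofReal_cpow_const s).aestronglyMeasurable, powMoment, powMoment,
    ← integral_prod_mul]
  exact integral_congr_ae (ae_prod_cpow_mul hμ hν s)

theorem absMoment_detLaw (N : ℕ) (s : ℂ) :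
    absMoment (detLaw N) s = ∏ k ∈ Finset.range N, absMoment (gammaLaw k) s := by
  induction N with
  | zero =>
    rw [absMoment, detLaw, lintegral_map (by fun_prop) (by fun_prop)]
    simp
  | succ N ih =>
    rw [detLaw_succ, absMoment_mconv ((ae_gammaLaw_pos N).mono fun _ => le_of_lt)
      (ae_detLaw_nonneg N), ih, Finset.prod_range_succ, mul_comm]

theorem powMoment_detLaw (N : ℕ) (s : ℂ) :
    powMoment (detLaw N) s = ∏ k ∈ Finset.range N, powMoment (gammaLaw k) s := by
  induction N with
  | zero =>
    rw [powMoment, detLaw, integral_map (measurable_norm_det_sq 0).aemeasurable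
      (measurable_ofReal_cpow_const s).aestronglyMeasurable]
    simp
  | succ N ih =>
    rw [detLaw_succ, powMoment_mconv ((ae_gammaLaw_pos N).mono fun _ => le_of_lt)
      (ae_detLaw_nonneg N), ih, Finset.prod_range_succ, mul_comm]

theorem ofReal_prod_cpow {N : ℕ} {x : Fin N → ℝ} (hx : ∀ j, 0 < x j) (s : ℂ) :
    ((∏ j, x j : ℝ) : ℂ) ^ s = ∏ j, (x j : ℂ) ^ s := by
  induction N with
  | zero => simp
  | succ N ih =>
    rw [Fin.prod_univ_succ, Fin.prod_univ_succ, ← ih fun j => hx j.succ, Complex.ofReal_mul,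
      Complex.mul_cpow_ofReal_nonneg (hx 0).le (Finset.prod_nonneg fun j _ => (hx j.succ).le)]

theorem absMoment_gammaProdLaw (k N : ℕ) (s : ℂ) :
    absMoment (gammaProdLaw k N) s = absMoment (gammaLaw k) s ^ N := by
  have h := lintegral_fin_prod_eq_prod (fun _ : Fin N => gammaLaw k)
    (f := fun _ x => ‖(x : ℂ) ^ s‖ₑ) fun _ => by fun_prop
  rw [Finset.prod_const, Finset.card_univ, Fintype.card_fin] at h
  rw [absMoment, gammaProdLaw, lintegral_map (by fun_prop) (by fun_prop), absMoment, ← h]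
  refine lintegral_congr_ae ?_
  filter_upwards [ae_pi_gammaLaw_pos k N] with x hx
  rw [ofReal_prod_cpow hx, ← ofReal_norm, norm_prod,
    ENNReal.ofReal_prod_of_nonneg fun _ _ => norm_nonneg _]
  simp only [ofReal_norm]

theorem powMoment_gammaProdLaw (k N : ℕ) (s : ℂ) :
    powMoment (gammaProdLaw k N) s = powMoment (gammaLaw k) s ^ N := by
  have h := integral_fintype_prod_eq_prod (μ := fun _ : Fin N => gammaLaw k)
    fun (_ : Fin N) (x : ℝ) => (x : ℂ) ^ s
  rw [Finset.prod_const, Finset.card_univ, Fintype.card_fin] at h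
  rw [powMoment, gammaProdLaw, integral_map (by fun_prop)
    (measurable_ofReal_cpow_const s).aestronglyMeasurable, powMoment, ← h]
  refine integral_congr_ae ?_
  filter_upwards [ae_pi_gammaLaw_pos k N] with x hx
  exact ofReal_prod_cpow hx s

theorem absMoment_detLaw_eq_mul_slaterLaw (n : ℕ) (s : ℂ) :
    absMoment (detLaw (n + 1)) s =
      absMoment (gammaLaw n) s ^ (n + 1) * absMoment (slaterLaw n) s := by
  rw [detLaw_eq_gammaProdLaw_mconv_slaterLaw, absMoment_mconv (ae_gammaProdLaw_nonneg _ _)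
    (ae_slaterLaw_nonneg n), absMoment_gammaProdLaw]

theorem powMoment_detLaw_eq_mul_slaterLaw (n : ℕ) (s : ℂ) :
    powMoment (detLaw (n + 1)) s =
      powMoment (gammaLaw n) s ^ (n + 1) * powMoment (slaterLaw n) s := by
  rw [detLaw_eq_gammaProdLaw_mconv_slaterLaw, powMoment_mconv (ae_gammaProdLaw_nonneg _ _)
    (ae_slaterLaw_nonneg n), powMoment_gammaProdLaw]

theorem absMoment_detLaw_ne_top (N : ℕ) {s : ℂ} (hs : -1 < s.re) :
    absMoment (detLaw N) s ≠ ∞ := by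
  rw [absMoment_detLaw]
  refine ENNReal.prod_ne_top fun k _ => lintegral_enorm_cpow_gammaLaw_ne_top k ?_
  have : (0 : ℝ) ≤ k := by positivity
  linarith

/-- At Re s = -1 the determinant moment diverges through its factor k = 0. The row lengths cannot be
responsible: their moment is finite when Re s + n + 1 = n > 0. The divergence must come from the
Slater law. -/
theorem absMoment_slaterLaw_eq_top {n : ℕ} (hn : 1 ≤ n) {s : ℂ} (hs : s.re = -1) :
    absMoment (slaterLaw n) s = ∞ := by
  have hdet : absMoment (detLaw (n + 1)) s = ∞ := by
    -- This splits off the factor k = 0, the one that is infinite.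
    rw [absMoment_detLaw, Finset.prod_range_succ', ENNReal.mul_eq_top]
    refine Or.inl ⟨Finset.prod_ne_zero_iff.2 fun k _ =>
      lintegral_enorm_cpow_gammaLaw_ne_zero _ s, ?_⟩
    exact lintegral_enorm_cpow_gammaLaw_eq_top 0 (by simp [hs])
  have hfin : absMoment (gammaLaw n) s ≠ ∞ := by
    refine lintegral_enorm_cpow_gammaLaw_ne_top n ?_
    have : (1 : ℝ) ≤ n := by exact_mod_cast hn
    linarith
  by_contra h
  rw [absMoment_detLaw_eq_mul_slaterLaw] at hdet
  exact ENNReal.mul_ne_top (ENNReal.pow_ne_top hfin) h hdet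

/-- On a probability measure, finiteness of a moment of order `Re s ≤ -1` forces finiteness of the
moment of order `-1`. -/
theorem absMoment_neg_one_ne_top {μ : Measure ℝ} [IsProbabilityMeasure μ] (hμ : ∀ᵐ x ∂μ, 0 ≤ x)
    {s : ℂ} (hs : s.re ≤ -1) (h : absMoment μ s ≠ ∞) : absMoment μ (-1) ≠ ∞ := by
  have hle : absMoment μ (-1) ≤ 1 + absMoment μ s := by
    have h1 : (1 : ℝ≥0∞) + absMoment μ s = ∫⁻ x : ℝ, (1 + ‖(x : ℂ) ^ s‖ₑ) ∂μ := by
      rw [lintegral_add_left measurable_const, absMoment]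
      simp
    rw [h1, absMoment]
    refine lintegral_mono_ae ?_
    filter_upwards [hμ] with x hx
    -- Pointwise x⁻¹ ≤ 1 + x^(Re s), according to whether x ≥ 1 or x ≤ 1. At x = 0 the convention
    -- 0^(-1) = 0 applies.
    rcases hx.eq_or_lt with rfl | hx
    · simp
    · rw [enorm_ofReal_cpow_of_pos hx, enorm_ofReal_cpow_of_pos hx]
      rcases le_total 1 x with h1 | h1
      · refine le_add_right ?_
        rw [← ENNReal.ofReal_one]
        exact ENNReal.ofReal_le_ofReal (Real.rpow_le_one_of_one_le_of_nonpos h1 (by simp))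
      · refine le_add_left (ENNReal.ofReal_le_ofReal ?_)
        exact Real.rpow_le_rpow_of_exponent_ge hx h1 (by simpa using hs)
  exact ne_top_of_le_ne_top (ENNReal.add_ne_top.2 ⟨ENNReal.one_ne_top, h⟩) hle

/-- Far to the left the row lengths have infinite moments too, and the product identity no longer
decides. Comparison with order -1 reduces every Re s ≤ -1 to the boundary case. -/
theorem absMoment_slaterLaw_ne_top_iff {n : ℕ} (hn : 1 ≤ n) (s : ℂ) :
    absMoment (slaterLaw n) s ≠ ∞ ↔ -1 < s.re := by
  constructor
  · intro h
    by_contra hs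
    exact absMoment_neg_one_ne_top (ae_slaterLaw_nonneg n) (not_lt.1 hs) h
      (absMoment_slaterLaw_eq_top hn (by simp))
  · intro hs h
    refine absMoment_detLaw_ne_top (n + 1) hs ?_
    rw [absMoment_detLaw_eq_mul_slaterLaw, h, ENNReal.mul_top]
    exact pow_ne_zero _ (lintegral_enorm_cpow_gammaLaw_ne_zero n s)

/-! ### The affine chart as an open embedding -/

theorem CPn.isQuotientMap_mk (n : ℕ) : Topology.IsQuotientMap
    fun v : {v : EuclideanSpace ℂ (Fin (n + 1)) // v ≠ 0} => Projectivization.mk ℂ v.1 v.2 :=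
  ⟨⟨rfl⟩, fun x => ⟨⟨x.rep, x.rep_nonzero⟩, x.mk_rep⟩⟩

theorem continuous_affineChart (n : ℕ) : Continuous (affineChart n) := by
  have h : Continuous fun z : Fin n → ℂ =>
      (⟨affineVec n z, affineVec_ne_zero n z⟩ : {v : EuclideanSpace ℂ (Fin (n + 1)) // v ≠ 0}) := by
    refine Continuous.subtype_mk ?_ _
    refine (PiLp.continuous_toLp 2 _).comp (continuous_pi fun i => ?_)
    refine Fin.cases ?_ (fun i => ?_) i
    · simpa using continuous_const
    · simpa using continuous_apply i
  exact (CPn.isQuotientMap_mk n).continuous.comp h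

/-- The affine coordinates `Zᵢ / Z₀` of a point of `ℙⁿ`. -/
def affineCoord (n : ℕ) (x : CPn n) : Fin n → ℂ := fun i => x.rep i.succ / x.rep 0

theorem affineCoord_mk {n : ℕ} (v : EuclideanSpace ℂ (Fin (n + 1))) (hv : v ≠ 0) :
    affineCoord n (Projectivization.mk ℂ v hv) = fun i => v i.succ / v 0 := by
  obtain ⟨a, ha⟩ := Projectivization.exists_smul_eq_mk_rep ℂ v hv
  ext i
  have h : ∀ j, (Projectivization.mk ℂ v hv).rep j = (a : ℂ) * v j := by
    intro j
    rw [← ha]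
    rfl
  rw [affineCoord, h, h, mul_div_mul_left _ _ a.ne_zero]

theorem leftInverse_affineCoord (n : ℕ) :
    Function.LeftInverse (affineCoord n) (affineChart n) := by
  intro z
  rw [affineChart, affineCoord_mk]
  ext i
  simp [affineVec]

theorem mk_mem_range_affineChart_iff {n : ℕ} (v : EuclideanSpace ℂ (Fin (n + 1))) (hv : v ≠ 0) :
    Projectivization.mk ℂ v hv ∈ Set.range (affineChart n) ↔ v 0 ≠ 0 := by
  constructor
  · rintro ⟨z, hz⟩ h0
    rw [affineChart, Projectivization.mk_eq_mk_iff'] at hz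
    obtain ⟨a, ha⟩ := hz
    have := congrArg (fun w : EuclideanSpace ℂ (Fin (n + 1)) => w 0) ha
    simp [h0, affineVec] at this
  · intro h0
    refine ⟨fun i => v i.succ / v 0, ?_⟩
    rw [affineChart, Projectivization.mk_eq_mk_iff']
    refine ⟨(v 0)⁻¹, ?_⟩
    ext i
    refine Fin.cases ?_ (fun i => ?_) i
    · simp [affineVec, h0]
    · simp [affineVec, div_eq_inv_mul]

/-- Openness is tested upstairs in ℂⁿ⁺¹ ∖ {0}: the preimage of the image of V is cut out by v 0 ≠ 0
and the condition that the continuous ratios lie in V. -/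
theorem isOpenMap_affineChart (n : ℕ) : IsOpenMap (affineChart n) := by
  intro V hV
  rw [← (CPn.isQuotientMap_mk n).isOpen_preimage]
  have : (fun v : {v : EuclideanSpace ℂ (Fin (n + 1)) // v ≠ 0} =>
      Projectivization.mk ℂ v.1 v.2) ⁻¹' (affineChart n '' V) =
      {v | v.1 0 ≠ 0} ∩ (fun v i => v.1 (Fin.succ i) / v.1 0) ⁻¹' V := by
    ext v
    constructor
    · rintro ⟨z, hz, hzv⟩
      refine ⟨(mk_mem_range_affineChart_iff v.1 v.2).1 ⟨z, hzv⟩, ?_⟩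
      have h := leftInverse_affineCoord n z
      rw [hzv, affineCoord_mk] at h
      rw [Set.mem_preimage, h]
      exact hz
    · rintro ⟨h0, hV⟩
      obtain ⟨z, hz⟩ := (mk_mem_range_affineChart_iff v.1 v.2).2 h0
      have h := leftInverse_affineCoord n z
      rw [hz, affineCoord_mk] at h
      refine ⟨z, ?_, hz⟩
      rw [← h]
      exact hV
  rw [this]
  refine ContinuousOn.isOpen_inter_preimage ?_ (isOpen_ne_fun (by fun_prop) continuous_const) hV
  refine continuousOn_pi.2 fun i => ContinuousOn.div ?_ ?_ fun v hv => hv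
  · exact Continuous.continuousOn (by fun_prop)
  · exact Continuous.continuousOn (by fun_prop)

theorem isOpenEmbedding_affineChart (n : ℕ) : Topology.IsOpenEmbedding (affineChart n) :=
  .of_continuous_injective_isOpenMap (continuous_affineChart n)
    (leftInverse_affineCoord n).injective (isOpenMap_affineChart n)

theorem measurableEmbedding_affineChart (n : ℕ) : MeasurableEmbedding (affineChart n) :=
  (isOpenEmbedding_affineChart n).measurableEmbedding

/-- Integrals and integrability transfer along a measurable embedding without measurability of the
integrand. This matters because `slaterNorm` is defined by chosen representatives. -/
theorem MeasurableEmbedding.pi_fin {N : ℕ} {X Y : Type*} [MeasurableSpace X] [MeasurableSpace Y]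
    {f : X → Y} (hf : MeasurableEmbedding f) [Nonempty X] :
    MeasurableEmbedding fun (x : Fin N → X) j => f (x j) := by
  refine MeasurableEmbedding.of_measurable_inverse (g := fun y j => hf.invFun (y j)) ?_ ?_ ?_ ?_
  · exact measurable_pi_lambda _ fun j => hf.measurable.comp (measurable_pi_apply j)
  · rw [show Set.range (fun (x : Fin N → X) j => f (x j)) =
      Set.univ.pi fun _ => Set.range f from Set.range_piMap fun _ => f]
    exact MeasurableSet.univ_pi fun _ => hf.measurableSet_range
  · exact measurable_pi_lambda _ fun j => hf.measurable_invFun.comp (measurable_pi_apply j)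
  · exact fun x => funext fun j => hf.leftInverse_invFun (x j)

/-! ### The partition function as a moment of the Slater law -/

/-- The total mass of the Fubini–Study volume form. -/
def fsMass (n : ℕ) : ℝ := (n ! * Real.pi⁻¹ ^ n)⁻¹

theorem fsMass_pos (n : ℕ) : 0 < fsMass n := by
  unfold fsMass
  have := Nat.factorial_pos n
  positivity

theorem fsVolume_eq_map (n : ℕ) :
    fsVolume n = (ENNReal.ofReal (fsMass n) • fsAffine n).map (affineChart n) := by
  rw [fsVolume, fsAffine, ← withDensity_smul _ (by fun_prop)]
  congr 2
  ext z
  have hne : (n ! * Real.pi⁻¹ ^ n : ℝ) ≠ 0 := by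
    have := Nat.factorial_pos n
    positivity
  rw [Pi.smul_apply, smul_eq_mul, ← ENNReal.ofReal_mul (fsMass_pos n).le, fsMass, ← mul_assoc,
    inv_mul_cancel₀ hne, one_mul]

theorem pi_fsVolume_eq_smul_map (n : ℕ) :
    (Measure.pi fun _ : Fin (n + 1) => fsVolume n) =
      ENNReal.ofReal (fsMass n ^ (n + 1)) • (Measure.pi fun _ : Fin (n + 1) => fsAffine n).map
        fun z j => affineChart n (z j) := by
  have hfin : IsFiniteMeasure (ENNReal.ofReal (fsMass n) • fsAffine n) :=
    Measure.smul_finite _ ENNReal.ofReal_ne_top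
  simp only [fsVolume_eq_map]
  rw [← Measure.pi_map_pi fun _ => (measurableEmbedding_affineChart n).measurable.aemeasurable,
    Measure.pi_fin_const_smul, Measure.map_smul, ENNReal.ofReal_pow (fsMass_pos n).le]

theorem ofReal_cpow_two_mul {t : ℝ} (ht : 0 ≤ t) (w : ℂ) :
    (t : ℂ) ^ (2 * w) = ((t ^ 2 : ℝ) : ℂ) ^ w := by
  have h := Complex.cpow_nat_mul (t : ℂ) 2 w
  rw [Nat.cast_ofNat] at h
  rw [h, sq, sq, Complex.ofReal_mul, Complex.mul_cpow_ofReal_nonneg ht ht]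

theorem partitionIntegrand_affineChart (n : ℕ) (β : ℂ) (z : Fin (n + 1) → Fin n → ℂ) :
    partitionIntegrand n β (fun j => affineChart n (z j)) =
      (slaterSq n z : ℂ) ^ (β * (n + 1)) := by
  have hexp : 2 * β / minLevel n = 2 * (β * (n + 1)) := by
    rw [minLevel, div_div_eq_mul_div, div_one, mul_assoc]
  have hmat : (Matrix.of fun i j => coordSection n i (affineVec n (z j))) =
      (Matrix.of fun j => (Fin.cons 1 (z j) : Fin (n + 1) → ℂ))ᵀ := rfl
  have hnorm : ∀ j, ‖affineVec n (z j)‖ ^ 2 = 1 + ∑ i, ‖z j i‖ ^ 2 := by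
    intro j
    rw [EuclideanSpace.norm_sq_eq, Fin.sum_univ_succ]
    simp [affineVec]
  rw [partitionIntegrand, hexp, ofReal_cpow_two_mul (by unfold slaterNorm; positivity)]
  congr 2
  unfold affineChart
  rw [slaterNorm_mk, hmat, det_transpose, div_pow, ← Finset.prod_pow, slaterSq]
  simp only [hnorm]

theorem integrable_partitionIntegrand_iff (n : ℕ) (β : ℂ) :
    Integrable (partitionIntegrand n β) (Measure.pi fun _ : Fin (n + 1) => fsVolume n) ↔
      absMoment (slaterLaw n) (β * (n + 1)) ≠ ∞ := by
  rw [pi_fsVolume_eq_smul_map, integrable_smul_measure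
    (by simpa using pow_pos (fsMass_pos n) _) ENNReal.ofReal_ne_top,
    (measurableEmbedding_affineChart n).pi_fin.integrable_map_iff, ← integrable_cpow_iff, slaterLaw,
    integrable_map_measure (measurable_ofReal_cpow_const _).aestronglyMeasurable (by fun_prop)]
  simp only [Function.comp_def, partitionIntegrand_affineChart]

theorem partitionFunction_eq_powMoment (n : ℕ) (β : ℂ) :
    partitionFunction n β =
      (fsMass n ^ (n + 1) : ℝ) * powMoment (slaterLaw n) (β * (n + 1)) := by
  rw [partitionFunction, pi_fsVolume_eq_smul_map, integral_smul_measure,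
    (measurableEmbedding_affineChart n).pi_fin.integral_map, powMoment, slaterLaw,
    integral_map (by fun_prop) (measurable_ofReal_cpow_const _).aestronglyMeasurable,
    ENNReal.toReal_ofReal (pow_nonneg (fsMass_pos n).le _), Complex.real_smul]
  simp only [partitionIntegrand_affineChart]

/-! ### The zeta integral as a Gaussian moment -/

theorem pi_gaussianVec_eq_withDensity (N : ℕ) :
    (Measure.pi fun _ : Fin N => gaussianVec N) =
      (volume : Measure (Fin N → Fin N → ℂ)).withDensity fun A =>
        ENNReal.ofReal ((Real.pi⁻¹ ^ N) ^ N * Real.exp (-∑ i, ∑ j, ‖A i j‖ ^ 2)) := by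
  have : SigmaFinite ((volume : Measure (Fin N → ℂ)).withDensity fun z =>
      ENNReal.ofReal (Real.pi⁻¹ ^ N * Real.exp (-∑ i, ‖z i‖ ^ 2))) := by
    rw [← gaussianVec_eq_withDensity]; infer_instance
  simp only [gaussianVec_eq_withDensity]
  rw [Measure.pi_fin_withDensity volume (by fun_prop)]
  congr 1
  ext A
  rw [← ENNReal.ofReal_prod_of_nonneg fun i _ => by positivity, Finset.prod_mul_distrib,
    ← Real.exp_sum]
  simp

theorem integrable_zetaIntegrand {N : ℕ} {s : ℂ} (h : absMoment (detLaw N) s ≠ ∞) :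
    Integrable (zetaIntegrand N s) := by
  rw [← integrable_cpow_iff, detLaw, integrable_map_measure
    (measurable_ofReal_cpow_const _).aestronglyMeasurable
    (measurable_norm_det_sq N).aemeasurable, pi_gaussianVec_eq_withDensity,
    integrable_withDensity_iff_integrable_smul' (by fun_prop)
      (Filter.Eventually.of_forall fun _ => ENNReal.ofReal_lt_top)] at h
  refine (h.const_mul (((Real.pi ^ N) ^ N : ℝ) : ℂ)).congr (Filter.Eventually.of_forall fun A => ?_)
  have hpi : (Real.pi : ℂ) ≠ 0 := by exact_mod_cast Real.pi_ne_zero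
  simp only [Function.comp_apply, zetaIntegrand, Complex.real_smul]
  rw [ENNReal.toReal_ofReal (by positivity)]
  push_cast
  rw [inv_pow, inv_pow]
  field_simp

theorem zetaIntegral_eq_powMoment (N : ℕ) (s : ℂ) :
    zetaIntegral N s = ((Real.pi ^ N) ^ N : ℝ) * powMoment (detLaw N) s := by
  have hpi : (Real.pi : ℂ) ≠ 0 := by exact_mod_cast Real.pi_ne_zero
  rw [powMoment, detLaw, integral_map (measurable_norm_det_sq N).aemeasurable
    (measurable_ofReal_cpow_const _).aestronglyMeasurable, pi_gaussianVec_eq_withDensity,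
    integral_withDensity_eq_integral_toReal_smul (by fun_prop)
      (Filter.Eventually.of_forall fun _ => ENNReal.ofReal_lt_top), ← integral_const_mul,
    zetaIntegral]
  refine integral_congr_ae (Filter.Eventually.of_forall fun A => ?_)
  simp only [zetaIntegrand, Complex.real_smul]
  rw [ENNReal.toReal_ofReal (by positivity)]
  push_cast
  rw [inv_pow, inv_pow]
  field_simp

/-! ### The Gamma quotient formula -/

theorem mem_strip_iff (n : ℕ) (β : ℂ) : β ∈ strip n ↔ -1 < (β * (n + 1)).re := by
  have hre : (β * (n + 1)).re = β.re * (n + 1) := by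
    rw [show ((n : ℂ) + 1) = ((n + 1 : ℝ) : ℂ) by push_cast; rfl, Complex.re_mul_ofReal]
  have hpos : (0 : ℝ) < n + 1 := by positivity
  rw [hre, strip, Set.mem_ofPred_eq, ← neg_div, div_lt_iff₀ hpos]

/-- Γ has no zeros, but `Complex.Gamma` takes the value 0 at its poles; the hypothesis keeps away
from these. -/
theorem Gamma_add_natCast_ne_zero {s : ℂ} (hs : ∀ m : ℕ, s ≠ -((m : ℂ) + 1)) (k : ℕ) :
    Complex.Gamma (s + k + 1) ≠ 0 := by
  refine Complex.Gamma_ne_zero fun m h => hs (m + k) ?_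
  push_cast
  linear_combination h

theorem ne_neg_of_neg_one_lt_re {s : ℂ} (hs : -1 < s.re) (m : ℕ) : s ≠ -((m : ℂ) + 1) := by
  rintro rfl
  simp only [Complex.neg_re, Complex.add_re, Complex.natCast_re, Complex.one_re] at hs
  have : (0 : ℝ) ≤ m := by positivity
  linarith

/-- The constant in the Gamma-quotient formula for the partition function. -/
def partitionConst (n : ℕ) : ℝ :=
  fsMass n ^ (n + 1) * (n ! : ℝ) ^ (n + 1) * ∏ k ∈ Finset.range (n + 1), (k ! : ℝ)⁻¹

theorem prod_inv_factorial_pos (N : ℕ) : 0 < ∏ k ∈ Finset.range N, (k ! : ℝ)⁻¹ :=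
  Finset.prod_pos fun k _ => inv_pos.2 (by exact_mod_cast Nat.factorial_pos k)

theorem partitionConst_pos (n : ℕ) : 0 < partitionConst n := by
  have h1 := fsMass_pos n
  have h2 := prod_inv_factorial_pos (n + 1)
  have h3 : (0 : ℝ) < n ! := by exact_mod_cast Nat.factorial_pos n
  unfold partitionConst
  positivity

theorem powMoment_detLaw_eq_prod_Gamma (N : ℕ) {s : ℂ} (hs : -1 < s.re) :
    powMoment (detLaw N) s = (∏ k ∈ Finset.range N, (k ! : ℝ)⁻¹ : ℝ) *
      ∏ k ∈ Finset.range N, Complex.Gamma (s + k + 1) := by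
  rw [powMoment_detLaw]
  push_cast
  rw [← Finset.prod_mul_distrib]
  refine Finset.prod_congr rfl fun k _ => integral_cpow_gammaLaw k ?_
  have : (0 : ℝ) ≤ k := by positivity
  linarith

theorem powMoment_slaterLaw_eq (n : ℕ) {s : ℂ} (hs : -1 < s.re) :
    powMoment (slaterLaw n) s =
      (n ! : ℂ) ^ (n + 1) * (Complex.Gamma (s + n + 1) ^ (n + 1))⁻¹ *
        powMoment (detLaw (n + 1)) s := by
  have hΓ := Gamma_add_natCast_ne_zero (ne_neg_of_neg_one_lt_re hs) n
  have hfac : (n ! : ℂ) ≠ 0 := by exact_mod_cast Nat.factorial_ne_zero n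
  have hγ : powMoment (gammaLaw n) s = (n ! : ℂ)⁻¹ * Complex.Gamma (s + n + 1) := by
    refine integral_cpow_gammaLaw n ?_
    have : (0 : ℝ) ≤ n := by positivity
    linarith
  rw [powMoment_detLaw_eq_mul_slaterLaw, hγ, mul_pow, inv_pow]
  field_simp

theorem Finset.prod_Icc_one_eq_prod_range {M : Type*} [CommMonoid M] (f : ℕ → M) (N : ℕ) :
    ∏ j ∈ Finset.Icc 1 N, f j = ∏ k ∈ Finset.range N, f (k + 1) := by
  induction N with
  | zero => simp
  | succ N ih =>
    rw [Finset.prod_Icc_succ_top (Nat.le_add_left 1 N), Finset.prod_range_succ, ih]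

theorem gammaQuotient_eq_prod_div {n : ℕ} {β : ℂ}
    (hβ : ∀ m : ℕ, β * (n + 1) ≠ -((m : ℂ) + 1)) :
    gammaQuotient n β = (∏ k ∈ Finset.range (n + 1), Complex.Gamma (β * (n + 1) + k + 1)) *
      (Complex.Gamma (β * (n + 1) + n + 1) ^ (n + 1))⁻¹ := by
  have hΓ := Gamma_add_natCast_ne_zero hβ n
  have hprod : ∏ j ∈ Finset.Icc 1 n, Complex.Gamma (β * (n + 1) + j) =
      ∏ k ∈ Finset.range n, Complex.Gamma (β * (n + 1) + k + 1) := by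
    rw [Finset.prod_Icc_one_eq_prod_range]
    refine Finset.prod_congr rfl fun k _ => ?_
    push_cast
    rw [add_assoc]
  rw [gammaQuotient, hprod, Finset.prod_range_succ, pow_succ]
  field_simp

theorem partitionFunction_eq_gammaQuotient {n : ℕ} {β : ℂ} (hβ : β ∈ strip n) :
    partitionFunction n β = partitionConst n * gammaQuotient n β := by
  rw [mem_strip_iff] at hβ
  rw [partitionFunction_eq_powMoment, powMoment_slaterLaw_eq n hβ,
    powMoment_detLaw_eq_prod_Gamma _ hβ, gammaQuotient_eq_prod_div (ne_neg_of_neg_one_lt_re hβ),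
    partitionConst]
  push_cast
  ring

/-! ### Meromorphic continuation, zeros and poles -/

/-- The polynomial `∏ᵢ (β(n+1) + i)ⁱ`, whose reciprocal is the Gamma quotient. -/
def poleDivisor (n : ℕ) (β : ℂ) : ℂ := ∏ i ∈ Finset.Icc 1 n, (β * (n + 1) + i) ^ i

theorem differentiable_poleDivisor (n : ℕ) : Differentiable ℂ (poleDivisor n) := by
  unfold poleDivisor
  fun_prop

theorem poleDivisor_ne_zero {n : ℕ} {β : ℂ} (hβ : ∀ m : ℕ, β * (n + 1) ≠ -((m : ℂ) + 1)) :
    poleDivisor n β ≠ 0 := by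
  refine Finset.prod_ne_zero_iff.2 fun i hi => pow_ne_zero _ fun h => ?_
  obtain ⟨m, rfl⟩ := Nat.exists_eq_add_of_le' (Finset.mem_Icc.1 hi).1
  refine hβ m ?_
  push_cast at h
  linear_combination h

/-- In the induction the numerator gains Γ(s+n+1), while the denominator becomes Γ(s+n+2)ⁿ⁺¹ =
(s+n+1)ⁿ⁺¹ Γ(s+n+1)ⁿ⁺¹. One Gamma factor cancels and the new linear factor appears to the power n+1.
-/
theorem prod_Gamma_div_pow {s : ℂ} (hs : ∀ m : ℕ, s ≠ -((m : ℂ) + 1)) (n : ℕ) :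
    (∏ j ∈ Finset.Icc 1 n, Complex.Gamma (s + j)) / Complex.Gamma (s + n + 1) ^ n =
      (∏ i ∈ Finset.Icc 1 n, (s + i) ^ i)⁻¹ := by
  induction n with
  | zero => simp
  | succ n ih =>
    have hΓ := Gamma_add_natCast_ne_zero hs n
    have hne : s + n + 1 ≠ 0 := fun h => hs n (by linear_combination h)
    rw [Finset.prod_Icc_succ_top (Nat.le_add_left 1 n),
      Finset.prod_Icc_succ_top (Nat.le_add_left 1 n), mul_inv, ← ih]
    push_cast
    rw [← add_assoc, Complex.Gamma_add_one _ hne, mul_pow, pow_succ (Complex.Gamma _)]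
    field_simp

theorem gammaQuotient_eq_inv_poleDivisor {n : ℕ} {β : ℂ}
    (hβ : ∀ m : ℕ, β * (n + 1) ≠ -((m : ℂ) + 1)) :
    gammaQuotient n β = (poleDivisor n β)⁻¹ :=
  prod_Gamma_div_pow hβ n

theorem eventually_poleDivisor_ne_zero (n : ℕ) (β : ℂ) :
    ∀ᶠ w in nhdsWithin β {β}ᶜ, poleDivisor n w ≠ 0 := by
  have hn : (n : ℂ) + 1 ≠ 0 := by exact_mod_cast Nat.succ_ne_zero n
  have hfactor : ∀ i ∈ Finset.Icc 1 n, ∀ᶠ w : ℂ in nhdsWithin β {β}ᶜ, w * (n + 1) + i ≠ 0 := by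
    intro i _
    -- A linear factor of nonzero slope that vanishes at β vanishes nowhere else; otherwise
    -- continuity suffices.
    by_cases h0 : β * (n + 1) + i = 0
    · filter_upwards [self_mem_nhdsWithin] with w hw h
      exact hw (mul_right_cancel₀ hn (by linear_combination h - h0))
    · have hc : ContinuousAt (fun w : ℂ => w * (n + 1) + i) β := by fun_prop
      exact (hc.eventually_ne h0).filter_mono nhdsWithin_le_nhds
  filter_upwards [(Finset.eventually_all _).2 hfactor] with w hw
  exact Finset.prod_ne_zero_iff.2 fun i hi => pow_ne_zero _ (hw i hi)

theorem meromorphic_const_mul_inv_poleDivisor (n : ℕ) (c : ℂ) :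
    Meromorphic fun β => c * (poleDivisor n β)⁻¹ := fun β =>
  (MeromorphicAt.const c β).mul ((differentiable_poleDivisor n).analyticAt β).meromorphicAt.inv

/-- A zero would make the product with the polynomial tend to 0, yet near β that product is the
constant c. -/
theorem meromorphicOrderAt_const_mul_inv_poleDivisor_nonpos (n : ℕ) {c : ℂ} (hc : c ≠ 0) (β : ℂ) :
    meromorphicOrderAt (fun β => c * (poleDivisor n β)⁻¹) β ≤ 0 := by
  by_contra! h
  have h1 := tendsto_zero_of_meromorphicOrderAt_pos h
  have h2 : Filter.Tendsto (poleDivisor n) (nhdsWithin β {β}ᶜ) (nhds (poleDivisor n β)) :=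
    (differentiable_poleDivisor n).continuous.continuousAt.tendsto.mono_left nhdsWithin_le_nhds
  have h3 : Filter.Tendsto (fun _ : ℂ => c) (nhdsWithin β {β}ᶜ) (nhds 0) := by
    have := h1.mul h2
    rw [zero_mul] at this
    refine this.congr' ?_
    filter_upwards [eventually_poleDivisor_ne_zero n β] with w hw
    rw [mul_assoc, inv_mul_cancel₀ hw, mul_one]
  exact hc (tendsto_nhds_unique tendsto_const_nhds h3)

theorem partitionFunction_eq_inv_poleDivisor {n : ℕ} {β : ℂ} (hβ : β ∈ strip n) :
    partitionFunction n β = partitionConst n * (poleDivisor n β)⁻¹ := by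
  rw [partitionFunction_eq_gammaQuotient hβ, gammaQuotient_eq_inv_poleDivisor
    (ne_neg_of_neg_one_lt_re ((mem_strip_iff n β).1 hβ))]

theorem poleDivisor_ne_zero_of_mem_strip {n : ℕ} {β : ℂ} (hβ : β ∈ strip n) :
    poleDivisor n β ≠ 0 :=
  poleDivisor_ne_zero (ne_neg_of_neg_one_lt_re ((mem_strip_iff n β).1 hβ))

theorem ofReal_partitionConst_ne_zero (n : ℕ) : (partitionConst n : ℂ) ≠ 0 := by
  exact_mod_cast (partitionConst_pos n).ne'

theorem differentiableOn_partitionFunction (n : ℕ) :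
    DifferentiableOn ℂ (partitionFunction n) (strip n) := by
  refine DifferentiableOn.congr (f := fun β => partitionConst n * (poleDivisor n β)⁻¹) ?_
    fun β hβ => partitionFunction_eq_inv_poleDivisor hβ
  exact ((differentiable_poleDivisor n).differentiableOn.inv
    fun β hβ => poleDivisor_ne_zero_of_mem_strip hβ).const_mul _

/-- The pole at `β = -1/(n+1)` obstructs any holomorphic extension. -/
theorem not_exists_extension_partitionFunction {n : ℕ} (hn : 1 ≤ n) {a : ℝ}
    (ha : a < -(1 / ((n : ℝ) + 1))) :
    ¬ ∃ F : ℂ → ℂ, DifferentiableOn ℂ F {β | a < β.re} ∧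
        Set.EqOn F (partitionFunction n) (strip n) := by
  rintro ⟨F, hF, hFeq⟩
  set β₀ : ℂ := ((-(1 / ((n : ℝ) + 1)) : ℝ) : ℂ) with hβ₀
  have hn0 : (n : ℂ) + 1 ≠ 0 := by exact_mod_cast Nat.succ_ne_zero n
  have hcont : ContinuousAt F β₀ := by
    refine (hF.differentiableAt (IsOpen.mem_nhds ?_ ?_)).continuousAt
    · exact isOpen_lt continuous_const Complex.continuous_re
    · rw [Set.mem_ofPred_eq, hβ₀, Complex.ofReal_re]
      exact ha
  -- The factor i = 1 vanishes here; it is present because n ≥ 1.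
  have hzero : poleDivisor n β₀ = 0 := by
    refine Finset.prod_eq_zero (Finset.mem_Icc.2 ⟨le_rfl, hn⟩) ?_
    rw [hβ₀]
    push_cast
    field_simp
    ring
  have hne : (nhdsWithin β₀ (strip n)).NeBot := by
    rw [← mem_closure_iff_nhdsWithin_neBot, strip, Complex.closure_setOfPred_lt_re,
      Set.mem_ofPred_eq, hβ₀, Complex.ofReal_re]
  -- On the strip this product is the nonzero constant `partitionConst n`, but continuity of F at
  -- the boundary point β₀ would force the limit 0.
  have hlim : Filter.Tendsto (fun β => F β * poleDivisor n β) (nhdsWithin β₀ (strip n))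
      (nhds (F β₀ * poleDivisor n β₀)) :=
    (hcont.mul (differentiable_poleDivisor n).continuous.continuousAt).tendsto.mono_left
      nhdsWithin_le_nhds
  have hconst : Filter.Tendsto (fun _ : ℂ => (partitionConst n : ℂ)) (nhdsWithin β₀ (strip n))
      (nhds 0) := by
    rw [hzero, mul_zero] at hlim
    refine hlim.congr' ?_
    filter_upwards [self_mem_nhdsWithin] with β hβ
    rw [hFeq hβ, partitionFunction_eq_inv_poleDivisor hβ, mul_assoc,
      inv_mul_cancel₀ (poleDivisor_ne_zero_of_mem_strip hβ), mul_one]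
  exact ofReal_partitionConst_ne_zero n (tendsto_nhds_unique tendsto_const_nhds hconst)

/-! ### The zeta integral and the standard L-factor -/

theorem partitionFunction_eq_zetaIntegral {n : ℕ} {β : ℂ} (hβ : β ∈ strip n) :
    partitionFunction n β =
      (fsMass n ^ (n + 1) * (n ! : ℝ) ^ (n + 1) * ((Real.pi ^ (n + 1)) ^ (n + 1))⁻¹ : ℝ) *
        (Complex.Gamma (β * (n + 1) + n + 1) ^ (n + 1))⁻¹ *
          zetaIntegral (n + 1) (β * (n + 1)) := by
  have hpi : (Real.pi : ℂ) ≠ 0 := by exact_mod_cast Real.pi_ne_zero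
  have hπ : ((Real.pi : ℂ) ^ (n + 1)) ^ (n + 1) ≠ 0 := by positivity
  rw [partitionFunction_eq_powMoment, powMoment_slaterLaw_eq n ((mem_strip_iff n β).1 hβ),
    zetaIntegral_eq_powMoment]
  push_cast
  linear_combination -((fsMass n : ℂ) ^ (n + 1) * (n ! : ℂ) ^ (n + 1) *
    (Complex.Gamma (β * (n + 1) + n + 1) ^ (n + 1))⁻¹ *
    powMoment (detLaw (n + 1)) (β * (n + 1))) * inv_mul_cancel₀ hπ

/-- The factor relating `∏ Γ_ℂ(s + k)` to `(2π)^{-Ns} ∏ Γ(s + k)`. -/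
def lFactorConst (N : ℕ) : ℝ := ∏ k ∈ Finset.range N, 2 * ((2 * Real.pi) ^ (k + 1))⁻¹

theorem lFactorConst_pos (N : ℕ) : 0 < lFactorConst N :=
  Finset.prod_pos fun k _ => by positivity

theorem Gammaℂ_add_natCast (s : ℂ) (k : ℕ) :
    Complex.Gammaℂ (s + k + 1) = (2 * Real.pi : ℂ) ^ (-s) *
      ((2 * ((2 * Real.pi) ^ (k + 1))⁻¹ : ℝ) * Complex.Gamma (s + k + 1)) := by
  have hpi : (2 * Real.pi : ℂ) ≠ 0 := by
    exact_mod_cast (mul_pos two_pos Real.pi_pos).ne'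
  rw [Complex.Gammaℂ_def, show -(s + k + 1) = -s + -((k + 1 : ℕ) : ℂ) by push_cast; ring,
    Complex.cpow_add _ _ hpi, Complex.cpow_neg _ ((k + 1 : ℕ) : ℂ), Complex.cpow_natCast]
  push_cast
  ring

/-- For N = n+1 the two half-integral shifts add up to n+2, so the arguments are s+n+2-j; reversing
the order of the factors gives s+1, …, s+n+1. -/
theorem standardLFactor_shift (n : ℕ) (s : ℂ) :
    standardLFactor (n + 1) (s + ((n : ℂ) + 2) / 2) =
      ∏ k ∈ Finset.range (n + 1), Complex.Gammaℂ (s + k + 1) := by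
  rw [standardLFactor, Finset.prod_Icc_one_eq_prod_range,
    ← Finset.prod_range_reflect (fun k : ℕ => Complex.Gammaℂ (s + k + 1))]
  refine Finset.prod_congr rfl fun k hk => ?_
  have hk : k ≤ n := Nat.lt_succ_iff.1 (Finset.mem_range.1 hk)
  rw [Nat.add_sub_cancel, Nat.cast_sub hk]
  congr 1
  push_cast
  ring

theorem two_pi_cpow_mul_standardLFactor (n : ℕ) (s : ℂ) :
    (2 * Real.pi : ℂ) ^ (((n : ℂ) + 1) * s) * standardLFactor (n + 1) (s + ((n : ℂ) + 2) / 2) =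
      lFactorConst (n + 1) * ∏ k ∈ Finset.range (n + 1), Complex.Gamma (s + k + 1) := by
  have hpi : (2 * Real.pi : ℂ) ≠ 0 := by
    exact_mod_cast (mul_pos two_pos Real.pi_pos).ne'
  rw [standardLFactor_shift]
  simp only [Gammaℂ_add_natCast, Finset.prod_mul_distrib]
  rw [Finset.prod_const, Finset.card_range, ← Complex.cpow_nat_mul, ← mul_assoc,
    ← Complex.cpow_add _ _ hpi, show ((n : ℂ) + 1) * s + ((n + 1 : ℕ) : ℂ) * -s = 0 by
      push_cast; ring, Complex.cpow_zero, one_mul, lFactorConst, Complex.ofReal_prod]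

theorem zetaIntegral_eq_standardLFactor {n : ℕ} {s : ℂ} (hs : -1 < s.re) :
    zetaIntegral (n + 1) s =
      ((Real.pi ^ (n + 1)) ^ (n + 1) * (∏ k ∈ Finset.range (n + 1), (k ! : ℝ)⁻¹) *
        (lFactorConst (n + 1))⁻¹ : ℝ) * (2 * Real.pi : ℂ) ^ (((n : ℂ) + 1) * s) *
          standardLFactor (n + 1) (s + ((n : ℂ) + 2) / 2) := by
  have hL : (lFactorConst (n + 1) : ℂ) ≠ 0 := by exact_mod_cast (lFactorConst_pos (n + 1)).ne'
  rw [mul_assoc, two_pi_cpow_mul_standardLFactor, zetaIntegral_eq_powMoment,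
    powMoment_detLaw_eq_prod_Gamma _ hs]
  push_cast
  field_simp

end

theorem mainTheorem9 (n : ℕ) (hn : 1 ≤ n) :
    -- the defining integral converges absolutely exactly on the strip
    (∀ β : ℂ, Integrable (partitionIntegrand n β)
        (Measure.pi fun _ : Fin (n + 1) => fsVolume n) ↔ β ∈ strip n) ∧
    -- the explicit formula, on the strip and for the meromorphic continuation `M`, which is
    -- zero-free on `ℂ`; the excluded `β` are those where some Gamma factor has a pole
    (∃ c : ℝ, 0 < c ∧
      (∀ β ∈ strip n, partitionFunction n β = c * gammaQuotient n β) ∧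
      ∃ M : ℂ → ℂ, Meromorphic M ∧
        Set.EqOn M (partitionFunction n) (strip n) ∧
        (∀ β : ℂ, (∀ m : ℕ, β * (n + 1) ≠ -((m : ℂ) + 1)) → M β = c * gammaQuotient n β) ∧
        ∀ β : ℂ, meromorphicOrderAt M β ≤ 0) ∧
    -- holomorphic and zero-free on the strip
    DifferentiableOn ℂ (partitionFunction n) (strip n) ∧
    (∀ β ∈ strip n, partitionFunction n β ≠ 0) ∧
    -- the strip is maximal: there is no holomorphic extension to a larger one
    (∀ a : ℝ, a < -(1 / ((n : ℝ) + 1)) →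
      ¬ ∃ F : ℂ → ℂ, DifferentiableOn ℂ F {β | a < β.re} ∧
        Set.EqOn F (partitionFunction n) (strip n)) ∧
    -- relation to the zeta integral and to the standard L-factor of `GL(n+1, ℂ)`, `s = β(n+1)`
    (∃ c₁ c₂ : ℝ, 0 < c₁ ∧ 0 < c₂ ∧ ∀ β ∈ strip n,
      Integrable (zetaIntegrand (n + 1) (β * (n + 1))) ∧
      partitionFunction n β =
        c₁ * (Complex.Gamma (β * (n + 1) + n + 1) ^ (n + 1))⁻¹ *
          zetaIntegral (n + 1) (β * (n + 1)) ∧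
      zetaIntegral (n + 1) (β * (n + 1)) =
        c₂ * (2 * Real.pi : ℂ) ^ (((n : ℂ) + 1) * (β * (n + 1))) *
          standardLFactor (n + 1) (β * (n + 1) + ((n : ℂ) + 2) / 2)) := by
  refine ⟨fun β => ?_, ⟨partitionConst n, partitionConst_pos n,
    fun β hβ => partitionFunction_eq_gammaQuotient hβ,
    -- At its poles this function has the junk value 0, so the absence of zeros is expressed by the
    -- order and not by values.
    fun β => partitionConst n * (poleDivisor n β)⁻¹, meromorphic_const_mul_inv_poleDivisor n _,
    fun β hβ => (partitionFunction_eq_inv_poleDivisor hβ).symm,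
    fun β hβ => by rw [gammaQuotient_eq_inv_poleDivisor hβ],
    meromorphicOrderAt_const_mul_inv_poleDivisor_nonpos n (ofReal_partitionConst_ne_zero n)⟩,
    differentiableOn_partitionFunction n, fun β hβ => ?_,
    fun a ha => not_exists_extension_partitionFunction hn ha,
    -- Both constants are found by unification with the two identities below; as `fsMass n` is
    -- πⁿ/n!, the first equals π^(-(n+1)).
    ⟨_, _, ?_, ?_, fun β hβ => ⟨integrable_zetaIntegrand
      (absMoment_detLaw_ne_top _ ((mem_strip_iff n β).1 hβ)),
      partitionFunction_eq_zetaIntegral hβ,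
      zetaIntegral_eq_standardLFactor ((mem_strip_iff n β).1 hβ)⟩⟩⟩
  · rw [integrable_partitionIntegrand_iff, absMoment_slaterLaw_ne_top_iff hn, mem_strip_iff]
  · rw [partitionFunction_eq_inv_poleDivisor hβ]
    exact mul_ne_zero (ofReal_partitionConst_ne_zero n)
      (inv_ne_zero (poleDivisor_ne_zero_of_mem_strip hβ))
  · have h1 := fsMass_pos n
    have h2 : (0 : ℝ) < n.factorial := by exact_mod_cast Nat.factorial_pos n
    positivity
  · have h1 := prod_inv_factorial_pos (n + 1)
    have h2 := lFactorConst_pos (n + 1)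
    positivity
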